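/- Let $d\in\{2,3\}$ and let $\Omega\subset\mathbb R^d$ be a polygonal/polyhedral domain: a connected open set with $\Omega=\operatorname{int}\overline\Omega$ whose closure is triangulated by a finite conforming simplicial mesh $\mathcal T_h$ of $d$-simplices $K$. Let $h=\max_K\operatorname{diam}K$, let $\mathcal F_{int}$ be the set of interior faces, $h_F=\operatorname{diam}F$, and let $n$ be the outer unit normal on $\partial\Omega$. Let $X_h^1$ be the space of continuous functions on $\overline\Omega$ that are affine on every $K$, let $V_h\subseteq X_h^1$ be any linear subspace, and let $a_h:V_h\times V_h\to\mathbb R$ be any bilinear form. Let $\mu>0$, and $\gamma_{1,F}>0$, $\gamma_{2,F}\ge 0$ for $F\in\mathcal F_{int}$, and put $$s_{cip}(u,v)=\sum_{F\in\mathcal F_{int}}\int_F\Big(h_F\gamma_{1,F}\,[\![\nabla u]\!]\cdot[\![\nabla v]\!]+h_F^3\gamma_{2,F}\,[\![\Delta u]\!]\,[\![\Delta v]\!]\Big)\,ds ,$$ where $[\![\cdot]\!]$ is the jump across $F$ of the elementwise quantity. For $y\in\{p,a\}$ (primal, adjoint) let $\Gamma_D^y,\Gamma_N^y\subseteq\partial\Omega$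 be measurable, possibly empty, let $\gamma_D^y,\gamma_N^y>0$, and put $$s_y(u,v)=s_{cip}(u,v)+\int_{\Gamma_D^y}\gamma_D^y\,\mu\,h^{-1}uv\,ds+\int_{\Gamma_N^y}\gamma_N^y\,h\,(\nabla u\cdot n)(\nabla v\cdot n)\,ds .$$ Given linear functionals $\ell_1,\ell_2$ on $V_h$, consider the system (FEM): find $(u_h,z_h)\in V_h\times V_h$ such that $$a_h(u_h,w_h)+s_a(z_h,w_h)=\ell_1(w_h),\qquad a_h(v_h,z_h)-s_p(u_h,v_h)=\ell_2(v_h)\qquad\text{for all }v_h,w_h\in V_h$$ (for example $\ell_1=(f,\cdot)$, $\ell_2=-s_p(u,\cdot)$ with $u$ the exact solution). A side of $\Omega$ is a flat part of $\partial\Omega$, contained in a hyperplane and with nonempty interior relative to that hyperplane. It is called a Dirichlet side for $y$ if it is contained in $\Gamma_D^y$ (weak imposition) or if all functions of $V_h$ vanish on it (strong imposition), and a penalised Neumann side for $y$ if it is contained in $\Gamma_N^y$. Then the solutions of the homogeneous system ($\ell_1=\ell_2=0$) form a linear space of dimension at most $2(d+1)$. Moreover, (FEM) has exactly one solution for all $\ell_1,\ell_2$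 if one of the following holds: 1. for each $y\in\{p,a\}$ there are two non-parallel Dirichlet sides; 2. for each $y\in\{p,a\}$ there are a Dirichlet side and a penalised Neumann side that are not orthogonal to each other; 3. for each $y\in\{p,a\}$ there are $d$ penalised Neumann sides whose normals are linearly independent, and in addition either $1\notin V_h$, or there are $v_h,w_h\in V_h$ with $a_h(1,v_h)\ne0$ and $a_h(w_h,1)\ne0$. -/

import Mathlib

open scoped MeasureTheory InnerProductSpace

noncomputable section

namespace CIP

variable {d : ℕ}

/-- The Euclidean space `ℝ^d`. -/
abbrev E (d : ℕ) : Type := EuclideanSpace ℝ (Fin d)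

/-- `Ω` is the interior of its closure, open and connected: together with the existence of a
triangulation (below) this says that `Ω` is a polygonal / polyhedral domain. -/
structure IsDomainSet (Ω : Set (E d)) : Prop where
  connected : IsConnected Ω
  regular : interior (closure Ω) = Ω

/-- A (conforming) triangulation of the closure of `Ω`: a finite simplicial complex, all of whose
maximal simplices are `d`-dimensional, and whose underlying set is the closure of `Ω`.
Simplices are represented by their vertex sets. -/
structure Triangulation (Ω : Set (E d)) extends Geometry.SimplicialComplex ℝ (E d) where
  finite_faces : faces.Finite
  pure : ∀ s ∈ faces, ∃ t ∈ faces, s ⊆ t ∧ t.card = d + 1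
  space_eq : toSimplicialComplex.space = closure Ω

/-- The geometric simplex with the given vertices. -/
def hull (s : Finset (E d)) : Set (E d) := convexHull ℝ (s : Set (E d))

namespace Triangulation

variable {Ω : Set (E d)} (T : Triangulation Ω)

/-- The elements `K` of the mesh: the `d`-simplices. -/
def cells : Finset (Finset (E d)) := T.finite_faces.toFinset.filter fun s => s.card = d + 1

/-- The `(d-1)`-dimensional faces of the mesh. -/
def facets : Finset (Finset (E d)) := T.finite_faces.toFinset.filter fun s => s.card = d

open Classical in
/-- The elements that have `F` as a face. -/
def cellsAt (F : Finset (E d)) : Finset (Finset (E d)) := T.cells.filter fun K => F ⊆ K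

/-- Interior faces: those shared by two elements. -/
def interiorFacets : Finset (Finset (E d)) := T.facets.filter fun F => (T.cellsAt F).card = 2

/-- Boundary faces: those belonging to a single element. -/
def boundaryFacets : Finset (Finset (E d)) := T.facets.filter fun F => (T.cellsAt F).card = 1

/-- The mesh size `h = max_K diam K`. -/
def meshSize : ℝ := ⨆ K : T.cells, Metric.diam (hull K.1)

/-- The space `X_h^1` of functions that are continuous on the closure of `Ω` and affine on every
element. Functions on the closure of `Ω` are represented by their extension by zero. -/
def P1 : Submodule ℝ (E d → ℝ) where
  carrier := {v | ContinuousOn v (closure Ω) ∧ (∀ x ∉ closure Ω, v x = 0) ∧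
    ∀ K ∈ T.cells, ∃ p : E d →ᵃ[ℝ] ℝ, Set.EqOn v p (hull K)}
  add_mem' := by
    rintro u v ⟨hu, hu0, hup⟩ ⟨hv, hv0, hvp⟩
    refine ⟨hu.add hv, fun x hx => by simp [hu0 x hx, hv0 x hx], fun K hK => ?_⟩
    obtain ⟨p, hp⟩ := hup K hK
    obtain ⟨q, hq⟩ := hvp K hK
    exact ⟨p + q, fun x hx => by simp [hp hx, hq hx]⟩
  zero_mem' := ⟨continuousOn_const, fun _ _ => rfl, fun _ _ => ⟨0, fun _ _ => rfl⟩⟩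
  smul_mem' := by
    rintro c v ⟨hv, hv0, hvp⟩
    refine ⟨hv.const_smul c, fun x hx => by simp [hv0 x hx], fun K hK => ?_⟩
    obtain ⟨p, hp⟩ := hvp K hK
    exact ⟨c • p, fun x hx => by simp [hp hx]⟩

end Triangulation

/-- The constant function `1` on the closure of `Ω` (extended by zero). -/
def one (Ω : Set (E d)) : E d → ℝ := (closure Ω).indicator fun _ => 1

/-- The gradient of `v|_K` at a point of `K` (one-sided at the boundary of `K`). -/
def grad (K : Finset (E d)) (v : E d → ℝ) (x : E d) : E d := gradientWithin v (hull K) x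

/-- The Laplacian of `v|_K` at a point of `K`. -/
def lap (K : Finset (E d)) (v : E d → ℝ) (x : E d) : ℝ :=
  InnerProductSpace.laplacianWithin v (hull K) x

/-- `ν` is the unit normal to the face `F` of `K` pointing out of `K`. -/
def IsOuterNormal (K F : Finset (E d)) (ν : E d) : Prop :=
  ‖ν‖ = 1 ∧ (∀ x ∈ F, ∀ y ∈ F, ⟪ν, y - x⟫_ℝ = 0) ∧ ∀ x ∈ F, ∀ y ∈ K, ⟪ν, y - x⟫_ℝ ≤ 0

/-- The outer unit normal to the face `F` of `K`. -/
def outerNormal (K F : Finset (E d)) : E d := Classical.epsilon (IsOuterNormal K F)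

/-- The continuous interior penalty form
`∑_{F interior} ∫_F (h_F γ₁ ⟦∇u⟧ · ⟦∇v⟧ + h_F³ γ₂ ⟦Δu⟧ ⟦Δv⟧)`.
Each interior face is shared by exactly two elements `K, K'`; the ordered pairs `(K, K')` and
`(K', K)` give the same contribution, whence the factor `1 / 2`. -/
def scip {Ω : Set (E d)} (T : Triangulation Ω) (γ₁ γ₂ : Finset (E d) → ℝ) (u v : E d → ℝ) : ℝ :=
  ∑ F ∈ T.interiorFacets, (1 / 2 : ℝ) * ∑ p ∈ (T.cellsAt F).offDiag,
    ∫ x in hull F,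
      (Metric.diam (hull F) * γ₁ F *
          ⟪grad p.1 u x - grad p.2 u x, grad p.1 v x - grad p.2 v x⟫_ℝ +
        Metric.diam (hull F) ^ 3 * γ₂ F *
          ((lap p.1 u x - lap p.2 u x) * (lap p.1 v x - lap p.2 v x))) ∂μHE[d - 1]

/-- The data of the weakly imposed boundary conditions: the Dirichlet part `ΓD` and the Neumann
part `ΓN` of the boundary, with the corresponding penalty parameters. Both parts may be empty. -/
structure WeakBC (Ω : Set (E d)) where
  ΓD : Set (E d)
  ΓN : Set (E d)
  γD : ℝ
  γN : ℝ
  ΓD_subset : ΓD ⊆ frontier Ω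
  ΓN_subset : ΓN ⊆ frontier Ω
  measurableSet_ΓD : MeasurableSet ΓD
  measurableSet_ΓN : MeasurableSet ΓN
  γD_pos : 0 < γD
  γN_pos : 0 < γN

/-- The Dirichlet penalty `∫_{ΓD} γD μ h⁻¹ u v ds`. -/
def dirichletPenalty {Ω : Set (E d)} (T : Triangulation Ω) (μ : ℝ) (B : WeakBC Ω)
    (u v : E d → ℝ) : ℝ :=
  ∫ x in B.ΓD, B.γD * μ * (T.meshSize)⁻¹ * (u x * v x) ∂μHE[d - 1]

/-- The Neumann penalty `∫_{ΓN} γN h (∇u · n) (∇v · n) ds`, split over the boundary faces; the sum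
over `T.cellsAt F` has a single term, the element adjacent to `F`. -/
def neumannPenalty {Ω : Set (E d)} (T : Triangulation Ω) (B : WeakBC Ω) (u v : E d → ℝ) : ℝ :=
  ∑ F ∈ T.boundaryFacets, ∑ K ∈ T.cellsAt F, ∫ x in hull F ∩ B.ΓN,
    B.γN * T.meshSize *
      (⟪grad K u x, outerNormal K F⟫_ℝ * ⟪grad K v x, outerNormal K F⟫_ℝ) ∂μHE[d - 1]

/-- The stabilisation operator with boundary conditions `B`. -/
def stab {Ω : Set (E d)} (T : Triangulation Ω) (γ₁ γ₂ : Finset (E d) → ℝ) (μ : ℝ) (B : WeakBC Ω)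
    (u v : E d → ℝ) : ℝ :=
  scip T γ₁ γ₂ u v + dirichletPenalty T μ B u v + neumannPenalty T B u v

/-- `(u, z)` solves the discrete system with right-hand sides `ℓ₁, ℓ₂`:
`a_h(u, w) + s_a(z, w) = ℓ₁(w)` for all `w` and `a_h(v, z) - s_p(u, v) = ℓ₂(v)` for all `v`. -/
def SolvesFEM {V : Submodule ℝ (E d → ℝ)} (ah : V →ₗ[ℝ] V →ₗ[ℝ] ℝ)
    (sp sa : (E d → ℝ) → (E d → ℝ) → ℝ) (ℓ₁ ℓ₂ : V →ₗ[ℝ] ℝ) (p : V × V) : Prop :=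
  (∀ w : V, ah p.1 w + sa p.2 w = ℓ₁ w) ∧ ∀ v : V, ah v p.2 - sp p.1 v = ℓ₂ v

/-- `S` is a side of `Ω` with unit normal `ν`: a flat part of the boundary, contained in a
hyperplane orthogonal to `ν` and with nonempty interior relative to that hyperplane. (Maximality is
not required, so a nondegenerate part of a side is also admitted.) -/
def IsSide (Ω S : Set (E d)) (ν : E d) : Prop :=
  S ⊆ frontier Ω ∧ ‖ν‖ = 1 ∧ ∃ c : ℝ, (∀ x ∈ S, ⟪ν, x⟫_ℝ = c) ∧
    ∃ x ∈ S, ∃ r > 0, ∀ y ∈ Metric.ball x r, ⟪ν, y⟫_ℝ = c → y ∈ S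

/-- There is a side with unit normal `ν` subject to a Dirichlet condition, either weakly through
the penalty term or strongly, all functions of the discrete space vanishing there. -/
def HasDirichletSide {Ω : Set (E d)} (V : Submodule ℝ (E d → ℝ)) (B : WeakBC Ω) (ν : E d) : Prop :=
  ∃ S, IsSide Ω S ν ∧ (S ⊆ B.ΓD ∨ ∀ v ∈ V, ∀ x ∈ S, v x = 0)

/-- There is a side with unit normal `ν` subject to a Neumann condition imposed by penalty. -/
def HasNeumannSide {Ω : Set (E d)} (B : WeakBC Ω) (ν : E d) : Prop :=
  ∃ S, IsSide Ω S ν ∧ S ⊆ B.ΓN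

/-- Two non-parallel Dirichlet sides. -/
def TwoDirichletSides {Ω : Set (E d)} (V : Submodule ℝ (E d → ℝ)) (B : WeakBC Ω) : Prop :=
  ∃ ν₁ ν₂ : E d, HasDirichletSide V B ν₁ ∧ HasDirichletSide V B ν₂ ∧
    LinearIndependent ℝ ![ν₁, ν₂]

/-- A Dirichlet side and a Neumann side that are not orthogonal. -/
def DirichletNeumannSides {Ω : Set (E d)} (V : Submodule ℝ (E d → ℝ)) (B : WeakBC Ω) : Prop :=
  ∃ ν₁ ν₂ : E d, HasDirichletSide V B ν₁ ∧ HasNeumannSide B ν₂ ∧ ⟪ν₁, ν₂⟫_ℝ ≠ 0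

/-- `d` Neumann sides with linearly independent normals. -/
def IndependentNeumannSides {Ω : Set (E d)} (B : WeakBC Ω) : Prop :=
  ∃ ν : Fin d → E d, (∀ i, HasNeumannSide B (ν i)) ∧ LinearIndependent ℝ ν

/-- Either `1 ∉ V`, or `a_h(1, v) ≠ 0` and `a_h(w, 1) ≠ 0` for some `v, w ∈ V`. -/
def ConstantsCondition (Ω : Set (E d)) {V : Submodule ℝ (E d → ℝ)}
    (ah : V →ₗ[ℝ] V →ₗ[ℝ] ℝ) : Prop :=
  one Ω ∉ V ∨ ∃ h1 : one Ω ∈ V, ∃ v w : V, ah ⟨one Ω, h1⟩ v ≠ 0 ∧ ah w ⟨one Ω, h1⟩ ≠ 0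

end CIP

end

/-!
The stabilisations `s_p` and `s_a` are positive semidefinite. Testing the homogeneous system with
`(z, u)` and subtracting the two equations gives `s_p(u, u) + s_a(z, z) = 0`, so both penalties
vanish: `u ∈ ker s_p` and `z ∈ ker s_a`.

A function in such a kernel has no gradient jump across interior facets. By continuity, the affine
functions on two neighbouring cells then coincide, so the function is affine near every point of `Ω`
outside the faces of codimension two. Removing finitely many affine subspaces of codimension two
does not disconnect small balls, hence the function is affine on the connected set `Ω`, which leaves
`d + 1` dimensions for each of `u` and `z`. A Dirichlet side makes the affine function vanish on a
hyperplane, so its gradient is parallel to the normal; a penalised Neumann side makes the gradient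
orthogonal to the normal.
-/

noncomputable section

namespace CIP

open Module Set Filter Topology MeasureTheory

section AffineSubspaces

variable {V : Type*} [NormedAddCommGroup V] [InnerProductSpace ℝ V]

theorem exists_isometry_range_eq {A : AffineSubspace ℝ V} {x : V} (hx : x ∈ A) :
    ∃ φ : A.direction → V, Isometry φ ∧ φ 0 = x ∧ range φ = A := by
  refine ⟨fun v => (v : V) +ᵥ x, (isometry_add_right x).comp A.direction.subtypeₗᵢ.isometry,
    by simp, ?_⟩
  ext y
  refine ⟨?_, fun hy => ⟨⟨y -ᵥ x, A.vsub_mem_direction hy hx⟩, by simp⟩⟩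
  rintro ⟨v, rfl⟩
  exact A.vadd_mem_of_mem_direction v.2 hx

variable [FiniteDimensional ℝ V]

theorem dimH_affineSubspace_le (A : AffineSubspace ℝ V) :
    dimH (A : Set V) ≤ finrank ℝ A.direction := by
  rcases (A : Set V).eq_empty_or_nonempty with hA | ⟨x, hx⟩
  · simp [hA]
  · obtain ⟨φ, hφ, -, hrange⟩ := exists_isometry_range_eq hx
    rw [← hrange, ← image_univ, hφ.dimH_image, Real.dimH_univ_eq_finrank]

theorem euclideanHausdorffMeasure_eq_zero_of_dimH_lt {X : Type*} [EMetricSpace X]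
    [MeasurableSpace X] [BorelSpace X] {s : Set X} {k : ℕ} (h : dimH s < k) : μHE[k] s = 0 := by
  have hnull : (μH[((k : NNReal) : ℝ)] : Measure X) s = 0 :=
    hausdorffMeasure_of_dimH_lt (by simpa using h)
  rw [NNReal.coe_natCast] at hnull
  rw [Measure.euclideanHausdorffMeasure_def, Measure.smul_apply, hnull, smul_zero]

variable [MeasurableSpace V] [BorelSpace V]

theorem euclideanHausdorffMeasure_affineSubspace_eq_zero {A : AffineSubspace ℝ V} {k : ℕ}
    (h : finrank ℝ A.direction < k) : μHE[k] (A : Set V) = 0 :=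
  euclideanHausdorffMeasure_eq_zero_of_dimH_lt
    ((dimH_affineSubspace_le A).trans_lt (by exact_mod_cast h))

theorem euclideanHausdorffMeasure_affineSubspace_inter_ball {A : AffineSubspace ℝ V} {x : V}
    (hx : x ∈ A) (r : ℝ) :
    μHE[finrank ℝ A.direction] (A ∩ Metric.ball x r) =
      volume (Metric.ball (0 : A.direction) r) := by
  obtain ⟨φ, hφ, rfl, hrange⟩ := exists_isometry_range_eq hx
  rw [← hrange, inter_comm, ← image_preimage_eq_inter_range, hφ.preimage_ball,
    hφ.euclideanHausdorffMeasure_image, InnerProductSpace.euclideanHausdorffMeasure_eq_volume]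

theorem euclideanHausdorffMeasure_lt_top_of_subset_affineSubspace {A : AffineSubspace ℝ V}
    {s : Set V} (hs : s ⊆ A) (hb : Bornology.IsBounded s) :
    μHE[finrank ℝ A.direction] s < ⊤ := by
  rcases s.eq_empty_or_nonempty with rfl | ⟨x, hx⟩
  · simp
  obtain ⟨r, hr⟩ := hb.subset_ball x
  refine (measure_mono (subset_inter hs hr)).trans_lt ?_
  rw [euclideanHausdorffMeasure_affineSubspace_inter_ball (hs hx)]
  exact measure_ball_lt_top

theorem euclideanHausdorffMeasure_affineSubspace_inter_pos {A : AffineSubspace ℝ V} {x : V}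
    (hx : x ∈ A) {s : Set V} (hs : s ∈ 𝓝 x) : 0 < μHE[finrank ℝ A.direction] (A ∩ s) := by
  obtain ⟨r, hr, hrs⟩ := Metric.mem_nhds_iff.1 hs
  refine lt_of_lt_of_le ?_ (measure_mono (inter_subset_inter_right _ hrs))
  rw [euclideanHausdorffMeasure_affineSubspace_inter_ball hx]
  exact Metric.measure_ball_pos _ _ hr

theorem euclideanHausdorffMeasure_pos_of_convex {s : Set V} (hs : Convex ℝ s) (hne : s.Nonempty) :
    0 < μHE[finrank ℝ (affineSpan ℝ s).direction] s := by
  obtain ⟨x, y, hy, -⟩ := hne.intrinsicInterior hs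
  obtain ⟨t, ht, hts⟩ := mem_nhds_subtype _ _ _ |>.1 (mem_interior_iff_mem_nhds.1 hy)
  refine (euclideanHausdorffMeasure_affineSubspace_inter_pos y.2 ht).trans_le (measure_mono ?_)
  exact fun z hz => hts (a := ⟨z, hz.1⟩) hz.2

theorem le_of_euclideanHausdorffMeasure_inter_pos {A B : AffineSubspace ℝ V}
    (h : 0 < μHE[finrank ℝ A.direction] (A ∩ B : Set V)) : A ≤ B := by
  by_contra hAB
  have hlt : A ⊓ B < A := inf_lt_left.2 hAB
  have hne : ((A ⊓ B : AffineSubspace ℝ V) : Set V).Nonempty := nonempty_of_measure_ne_zero h.ne'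
  refine h.ne' (euclideanHausdorffMeasure_affineSubspace_eq_zero (A := A ⊓ B) ?_)
  exact Submodule.finrank_lt_finrank_of_lt (AffineSubspace.direction_lt_of_nonempty hlt hne)

end AffineSubspaces

section LocallyAffine

variable {V W : Type*} [NormedAddCommGroup V] [NormedSpace ℝ V] [NormedAddCommGroup W]
  [NormedSpace ℝ W]

theorem affineMap_eq_of_eventuallyEq {p q : V →ᵃ[ℝ] W} {x : V} (h : p =ᶠ[𝓝 x] q) : p = q :=
  AffineMap.ext_on
    (isOpen_interior.affineSpan_eq_top ⟨x, mem_interior_iff_mem_nhds.2 h⟩) interior_subset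

theorem eventuallyEq_affineMap_of_isPreconnected {u : V → W} {S : Set V} (hS : IsPreconnected S)
    (hloc : ∀ x ∈ S, ∃ p : V →ᵃ[ℝ] W, u =ᶠ[𝓝 x] p) {p : V →ᵃ[ℝ] W} {x : V} (hx : x ∈ S)
    (hp : u =ᶠ[𝓝 x] p) {y : V} (hy : y ∈ S) : u =ᶠ[𝓝 y] p := by
  have hopen : IsOpen {z | u =ᶠ[𝓝 z] p} := isOpen_setOfPred_eventually_nhds
  refine hS.subset_of_closure_inter_subset hopen ⟨x, hx, hp⟩ ?_ hy
  rintro z ⟨hz, hzS⟩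
  obtain ⟨q, hq⟩ := hloc z hzS
  obtain ⟨w, hwq, hwp⟩ := mem_closure_iff_nhds.1 hz _ (eventually_eventually_nhds.2 hq)
  have hqp : q = p := affineMap_eq_of_eventuallyEq (EventuallyEq.trans (EventuallyEq.symm hwq) hwp)
  exact hqp ▸ hq

theorem mem_affineSpan_insert_of_mem_segment {A : AffineSubspace ℝ V} {x z w : V}
    (hw : w ∈ segment ℝ x z) (hwx : w ≠ x) (hwA : w ∈ A) :
    z ∈ affineSpan ℝ (insert x (A : Set V)) := by
  obtain ⟨t, -, rfl⟩ := segment_eq_image_lineMap ℝ x z ▸ hw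
  have ht : t ≠ 0 := by
    rintro rfl
    simp at hwx
  have hz := AffineMap.lineMap_mem t⁻¹ (subset_affineSpan ℝ _ (mem_insert x (A : Set V)))
    (subset_affineSpan ℝ _ (mem_insert_of_mem x hwA))
  simpa [AffineMap.lineMap_apply, smul_smul, ht] using hz

theorem affineSubspace_ne_top_of_finrank_lt {A : AffineSubspace ℝ V}
    (h : finrank ℝ A.direction < finrank ℝ V) : A ≠ ⊤ := by
  rintro rfl
  rw [AffineSubspace.direction_top, finrank_top] at h
  exact h.false

variable [FiniteDimensional ℝ V]

theorem dense_compl_biUnion_affineSubspace {𝒜 : Set (AffineSubspace ℝ V)} (h𝒜 : 𝒜.Countable)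
    (htop : ∀ A ∈ 𝒜, A ≠ ⊤) : Dense (⋃ A ∈ 𝒜, (A : Set V))ᶜ := by
  borelize V
  refine Measure.dense_of_ae (μ := Measure.addHaar) (compl_mem_ae_iff.2 ?_)
  exact (measure_biUnion_null_iff h𝒜).2 fun A hA => Measure.addHaar_affineSubspace _ A (htop A hA)

-- From any point `x` at which `u` is locally affine, almost every segment issued from `x` misses
-- the exceptional subspaces, because the cones over them with vertex `x` still have empty interior.
theorem exists_affineMap_eqOn_of_convex {C : Set V} (hCo : IsOpen C) (hCc : Convex ℝ C)
    {u : V → W} (hu : ContinuousOn u C) {𝒜 : Set (AffineSubspace ℝ V)} (h𝒜 : 𝒜.Countable)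
    (hdim : ∀ A ∈ 𝒜, finrank ℝ A.direction + 2 ≤ finrank ℝ V)
    (hloc : ∀ x ∈ C, (∀ A ∈ 𝒜, x ∉ A) → ∃ p : V →ᵃ[ℝ] W, u =ᶠ[𝓝 x] p) :
    ∃ p : V →ᵃ[ℝ] W, EqOn u p C := by
  rcases C.eq_empty_or_nonempty with rfl | hne
  · exact ⟨0, eqOn_empty _ _⟩
  obtain ⟨x, hxC, hx⟩ := (dense_compl_biUnion_affineSubspace h𝒜 fun A hA =>
    affineSubspace_ne_top_of_finrank_lt (by grind)).inter_open_nonempty C hCo hne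
  obtain ⟨p, hp⟩ := hloc x hxC (by simpa using hx)
  let cones := (fun A : AffineSubspace ℝ V => affineSpan ℝ (insert x (A : Set V))) '' 𝒜
  have hdense : Dense (⋃ B ∈ cones, (B : Set V))ᶜ := by
    refine dense_compl_biUnion_affineSubspace (h𝒜.image _) ?_
    rintro _ ⟨A, hA, rfl⟩
    refine affineSubspace_ne_top_of_finrank_lt ?_
    rw [direction_affineSpan]
    have := finrank_vectorSpan_insert_le A x
    have := hdim A hA
    omega
  have heq : EqOn u p (C ∩ (⋃ B ∈ cones, (B : Set V))ᶜ) := by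
    rintro z ⟨hzC, hz⟩
    refine (eventuallyEq_affineMap_of_isPreconnected (convex_segment x z).isPreconnected
      (fun w hw => ?_) (left_mem_segment ℝ x z) hp (right_mem_segment ℝ x z)).self_of_nhds
    rcases eq_or_ne w x with rfl | hwx
    · exact ⟨p, hp⟩
    · refine hloc w (hCc.segment_subset hxC hzC hw) fun A hA hwA => hz ?_
      exact mem_biUnion (mem_image_of_mem _ hA) (mem_affineSpan_insert_of_mem_segment hw hwx hwA)
  exact ⟨p, heq.of_subset_closure hu p.continuous_of_finiteDimensional.continuousOn
    inter_subset_left (hdense.open_subset_closure_inter hCo)⟩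

theorem exists_affineMap_eqOn_of_isPreconnected {Ω : Set V} (hΩo : IsOpen Ω)
    (hΩc : IsPreconnected Ω) {u : V → W} (hu : ContinuousOn u Ω) {𝒜 : Set (AffineSubspace ℝ V)}
    (h𝒜 : 𝒜.Countable) (hdim : ∀ A ∈ 𝒜, finrank ℝ A.direction + 2 ≤ finrank ℝ V)
    (hloc : ∀ x ∈ Ω, (∀ A ∈ 𝒜, x ∉ A) → ∃ p : V →ᵃ[ℝ] W, u =ᶠ[𝓝 x] p) :
    ∃ p : V →ᵃ[ℝ] W, EqOn u p Ω := by
  have haffine : ∀ x ∈ Ω, ∃ p : V →ᵃ[ℝ] W, u =ᶠ[𝓝 x] p := by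
    intro x hx
    obtain ⟨r, hr, hball⟩ := Metric.isOpen_iff.1 hΩo x hx
    obtain ⟨p, hp⟩ := exists_affineMap_eqOn_of_convex Metric.isOpen_ball (convex_ball x r)
      (hu.mono hball) h𝒜 hdim fun y hy => hloc y (hball hy)
    exact ⟨p, hp.eventuallyEq_of_mem (Metric.ball_mem_nhds x hr)⟩
  rcases Ω.eq_empty_or_nonempty with rfl | ⟨x, hx⟩
  · exact ⟨0, eqOn_empty _ _⟩
  obtain ⟨p, hp⟩ := haffine x hx
  exact ⟨p, fun y hy =>
    (eventuallyEq_affineMap_of_isPreconnected hΩc haffine hx hp hy).self_of_nhds⟩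

end LocallyAffine

section Gradient

variable {V : Type*} [NormedAddCommGroup V] [InnerProductSpace ℝ V] [FiniteDimensional ℝ V]

/-- The constant gradient of an affine function, depending linearly on the function. -/
def affineGrad : (V →ᵃ[ℝ] ℝ) →ₗ[ℝ] V where
  toFun p := (InnerProductSpace.toDual ℝ V).symm (LinearMap.toContinuousLinearMap p.linear)
  map_add' p q := by simp
  map_smul' c p := by simp

theorem inner_affineGrad (p : V →ᵃ[ℝ] ℝ) (w : V) : ⟪affineGrad p, w⟫_ℝ = p.linear w := by
  simp [affineGrad, InnerProductSpace.toDual_symm_apply]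

theorem inner_affineGrad_sub (p : V →ᵃ[ℝ] ℝ) (x y : V) : ⟪affineGrad p, y - x⟫_ℝ = p y - p x := by
  rw [inner_affineGrad, ← vsub_eq_sub y x, p.linearMap_vsub, vsub_eq_sub]

theorem affineMap_eq_of_affineGrad_eq {p q : V →ᵃ[ℝ] ℝ} (hgrad : affineGrad p = affineGrad q)
    {x : V} (hx : p x = q x) : p = q := by
  ext y
  linarith [inner_affineGrad_sub p x y, inner_affineGrad_sub q x y,
    congrArg (⟪·, y - x⟫_ℝ) hgrad]

theorem hasGradientAt_affineMap (p : V →ᵃ[ℝ] ℝ) (x : V) : HasGradientAt p (affineGrad p) x := by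
  let q : V →ᴬ[ℝ] ℝ := ⟨p, p.continuous_of_finiteDimensional⟩
  have hq : q.contLinear = InnerProductSpace.toDual ℝ V (affineGrad p) :=
    ContinuousLinearMap.ext fun w => (inner_affineGrad p w).symm
  exact hasGradientAt_iff_hasFDerivAt.2 (hq ▸ q.hasFDerivAt)

variable {s : Set V} {v : V → ℝ} {p : V →ᵃ[ℝ] ℝ} {x : V}

theorem fderivWithin_eq_of_eqOn_affineMap (hs : UniqueDiffOn ℝ s) (hv : EqOn v p s) (hx : x ∈ s) :
    fderivWithin ℝ v s x = InnerProductSpace.toDual ℝ V (affineGrad p) := by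
  rw [fderivWithin_congr hv (hv hx)]
  exact (hasGradientAt_affineMap p x).hasFDerivAt.hasFDerivWithinAt.fderivWithin (hs x hx)

theorem gradientWithin_eq_of_eqOn_affineMap (hs : UniqueDiffOn ℝ s) (hv : EqOn v p s)
    (hx : x ∈ s) : gradientWithin v s x = affineGrad p := by
  rw [gradientWithin, fderivWithin_eq_of_eqOn_affineMap hs hv hx,
    LinearIsometryEquiv.symm_apply_apply]

theorem laplacianWithin_eq_zero_of_eqOn_affineMap (hs : UniqueDiffOn ℝ s) (hv : EqOn v p s)
    (hx : x ∈ s) : InnerProductSpace.laplacianWithin v s x = 0 := by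
  have hconst : EqOn (fderivWithin ℝ v s)
      (fun _ => InnerProductSpace.toDual ℝ V (affineGrad p)) s :=
    fun y hy => fderivWithin_eq_of_eqOn_affineMap hs hv hy
  rw [InnerProductSpace.laplacianWithin_eq_iteratedFDerivWithin_stdOrthonormalBasis v hs hx]
  refine Finset.sum_eq_zero fun i _ => ?_
  rw [iteratedFDerivWithin_two_apply _ hs hx, fderivWithin_congr hconst (hconst hx)]
  simp

theorem frequently_affineMap_pos (hp : p ≠ 0) (hx : p x = 0) : ∃ᶠ y in 𝓝 x, 0 < p y := by
  have hlin : p.linear ≠ 0 := by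
    intro h
    refine hp (affineMap_eq_of_affineGrad_eq (ext_inner_right ℝ fun w => ?_) hx)
    simp [inner_affineGrad, h]
  have hopen : IsOpenMap p := AffineMap.isOpenMap_linear_iff.1
    (p.linear.isOpenMap_of_finiteDimensional (LinearMap.surjective hlin))
  have hmap : map p (𝓝 x) = 𝓝 0 := by
    rw [hopen.map_nhds_eq p.continuous_of_finiteDimensional.continuousAt, hx]
  have : ∃ᶠ t : ℝ in map p (𝓝 x), 0 < t := hmap ▸ frequently_gt_nhds 0
  exact this

theorem frequently_affineMap_neg (hp : p ≠ 0) (hx : p x = 0) : ∃ᶠ y in 𝓝 x, p y < 0 := by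
  simpa using frequently_affineMap_pos (neg_ne_zero.2 hp) (p := -p) (x := x) (by simp [hx])

end Gradient

section Barycentric

variable {ι V : Type*} [Finite ι] [NormedAddCommGroup V] [NormedSpace ℝ V]
  (b : AffineBasis ι ℝ V)

theorem mem_convexHull_image_iff_coord {s : Set ι} {x : V} :
    x ∈ convexHull ℝ (b '' s) ↔ (∀ i, 0 ≤ b.coord i x) ∧ ∀ i ∉ s, b.coord i x = 0 := by
  classical
  cases nonempty_fintype ι
  constructor
  · intro hx
    refine ⟨?_, fun i hi => ?_⟩
    · have := convexHull_mono (image_subset_range b s) hx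
      rwa [b.convexHull_eq_nonneg_coord] at this
    · refine (b.coord i).eqOn_affineSpan (g := 0) ?_ (convexHull_subset_affineSpan _ hx)
      rintro _ ⟨j, hj, rfl⟩
      simpa using b.coord_apply_ne (ne_of_mem_of_not_mem hj hi).symm
  · rintro ⟨hnonneg, hzero⟩
    have hs : ∀ i, b.coord i x ≠ 0 → i ∈ s := fun i => not_imp_comm.1 (hzero i)
    rw [← b.linear_combination_coord_eq_self x,
      ← Finset.sum_filter_of_ne (p := (· ∈ s)) fun i _ hi => hs i (left_ne_zero_of_smul hi)]
    refine (convex_convexHull ℝ _).sum_mem (fun i _ => hnonneg i) ?_ fun i hi =>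
      subset_convexHull ℝ _ (mem_image_of_mem b (Finset.mem_filter.1 hi).2)
    rw [Finset.sum_filter_of_ne fun i _ => hs i, b.sum_coord_apply_eq_one]

theorem eventually_mem_convexHull_range_iff [FiniteDimensional ℝ V] {i : ι} {x : V}
    (hx : ∀ j ≠ i, 0 < b.coord j x) :
    ∀ᶠ y in 𝓝 x, y ∈ convexHull ℝ (range b) ↔ 0 ≤ b.coord i y := by
  have hpos : ∀ᶠ y in 𝓝 x, ∀ j ≠ i, 0 < b.coord j y := by
    simp only [eventually_all]
    exact fun j hj => (b.coord j).continuous_of_finiteDimensional.continuousAt.eventually_const_lt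
      (hx j hj)
  filter_upwards [hpos] with y hy
  rw [b.convexHull_eq_nonneg_coord]
  refine ⟨fun h => h i, fun h j => ?_⟩
  rcases eq_or_ne j i with rfl | hj
  · exact h
  · exact (hy j hj).le

end Barycentric

variable {d : ℕ}

section Hull

variable {s t : Finset (E d)}

theorem hull_mono (h : s ⊆ t) : hull s ⊆ hull t := convexHull_mono (by exact_mod_cast h)

theorem subset_hull : (s : Set (E d)) ⊆ hull s := subset_convexHull ℝ _

theorem convex_hull : Convex ℝ (hull s) := convex_convexHull ℝ _

theorem isCompact_hull : IsCompact (hull s) := s.finite_toSet.isCompact_convexHull ℝ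

theorem hull_nonempty_iff : (hull s).Nonempty ↔ s.Nonempty := by
  rw [hull, convexHull_nonempty_iff, Finset.coe_nonempty]

theorem hull_subset_affineSpan : hull s ⊆ affineSpan ℝ (s : Set (E d)) :=
  convexHull_subset_affineSpan _

theorem affineSpan_hull : affineSpan ℝ (hull s) = affineSpan ℝ (s : Set (E d)) :=
  affineSpan_convexHull _

theorem diam_hull_pos (h : 1 < s.card) : 0 < Metric.diam (hull s) := by
  obtain ⟨a, ha, b, hb, hab⟩ := Finset.one_lt_card.1 h
  exact (dist_pos.2 hab).trans_le
    (Metric.dist_le_diam_of_mem isCompact_hull.isBounded (subset_hull ha) (subset_hull hb))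

end Hull

namespace Triangulation

variable {Ω : Set (E d)} {T : Triangulation Ω} {s F K K' : Finset (E d)} {x : E d}

section Cells

theorem mem_cells : K ∈ T.cells ↔ K ∈ T.faces ∧ K.card = d + 1 := by simp [cells]

theorem mem_facets : F ∈ T.facets ↔ F ∈ T.faces ∧ F.card = d := by simp [facets]

theorem mem_cellsAt : K ∈ T.cellsAt F ↔ K ∈ T.cells ∧ F ⊆ K := by simp [cellsAt]

theorem mem_interiorFacets : F ∈ T.interiorFacets ↔ F ∈ T.facets ∧ (T.cellsAt F).card = 2 := by
  simp [interiorFacets]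

theorem mem_boundaryFacets : F ∈ T.boundaryFacets ↔ F ∈ T.facets ∧ (T.cellsAt F).card = 1 := by
  simp [boundaryFacets]

variable (T) in
theorem closure_eq_biUnion_cells : closure Ω = ⋃ K ∈ T.cells, hull K := by
  rw [← T.space_eq]
  ext x
  simp only [Geometry.SimplicialComplex.mem_space_iff, mem_iUnion, exists_prop]
  constructor
  · rintro ⟨s, hs, hx⟩
    obtain ⟨K, hK, hsK, hcard⟩ := T.pure s hs
    exact ⟨K, mem_cells.2 ⟨hK, hcard⟩, hull_mono hsK hx⟩
  · rintro ⟨K, hK, hx⟩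
    exact ⟨K, (mem_cells.1 hK).1, hx⟩

theorem hull_subset_closure (hK : K ∈ T.cells) : hull K ⊆ closure Ω := by
  rw [T.closure_eq_biUnion_cells]
  exact subset_biUnion_of_mem (u := fun K => hull K) hK

variable (T) in
theorem exists_mem_hull_cell (hx : x ∈ closure Ω) : ∃ K ∈ T.cells, x ∈ hull K := by
  simpa [T.closure_eq_biUnion_cells] using hx

theorem isCompact_closure (T : Triangulation Ω) : IsCompact (closure Ω) := by
  rw [T.closure_eq_biUnion_cells]
  exact T.cells.isCompact_biUnion fun K _ => isCompact_hull

variable (T) in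
theorem cells_nonempty (hΩ : Ω.Nonempty) : T.cells.Nonempty := by
  obtain ⟨x, hx⟩ := hΩ
  obtain ⟨K, hK, -⟩ := T.exists_mem_hull_cell (subset_closure hx)
  exact ⟨K, hK⟩

variable (T) in
theorem meshSize_pos (hd : 0 < d) (hΩ : Ω.Nonempty) : 0 < T.meshSize := by
  obtain ⟨K, hK⟩ := T.cells_nonempty hΩ
  refine (diam_hull_pos (s := K) (by rw [(mem_cells.1 hK).2]; omega)).trans_le ?_
  exact le_ciSup (f := fun K : T.cells => Metric.diam (hull K.1)) (Set.finite_range _).bddAbove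
    ⟨K, hK⟩

theorem mem_hull_inter [DecidableEq (E d)] (hs : s ∈ T.faces) (hK : K ∈ T.faces)
    (hxs : x ∈ hull s) (hxK : x ∈ hull K) : x ∈ hull (s ∩ K) := by
  rw [hull, Finset.coe_inter]
  exact T.inter_subset_convexHull hs hK ⟨hxs, hxK⟩

theorem finrank_direction_face (hs : s ∈ T.faces) :
    finrank ℝ (affineSpan ℝ (s : Set (E d))).direction + 1 = s.card := by
  have hpos : 0 < s.card := (T.nonempty_of_mem_faces hs).card_pos
  have hrank := (T.indep hs).finrank_vectorSpan (n := s.card - 1) (by simp; omega)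
  rw [Subtype.range_coe_subtype, Finset.setOfPred_mem] at hrank
  rw [direction_affineSpan]
  omega

theorem affineSpan_cell (hK : K ∈ T.cells) : affineSpan ℝ (K : Set (E d)) = ⊤ := by
  obtain ⟨hKf, hcard⟩ := mem_cells.1 hK
  have := (T.indep hKf).affineSpan_eq_top_iff_card_eq_finrank_add_one.2 (by simpa using hcard)
  rwa [Subtype.range_coe_subtype, Finset.setOfPred_mem] at this

theorem affineMap_eq_of_eqOn_cell {W : Type*} [AddCommGroup W] [Module ℝ W] (hK : K ∈ T.cells)
    {p q : E d →ᵃ[ℝ] W} (h : EqOn p q K) : p = q :=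
  AffineMap.ext_on (affineSpan_cell hK) h

theorem nonempty_interior_hull (hK : K ∈ T.cells) : (interior (hull K)).Nonempty :=
  interior_convexHull_nonempty_iff_affineSpan_eq_top.2 (affineSpan_cell hK)

theorem uniqueDiffOn_hull (hK : K ∈ T.cells) : UniqueDiffOn ℝ (hull K) :=
  uniqueDiffOn_convex convex_hull (nonempty_interior_hull hK)

/-- The vertices of a cell as an affine basis, which provides its barycentric coordinates. -/
def cellBasis (hK : K ∈ T.cells) : AffineBasis K ℝ (E d) where
  toFun := (↑)
  ind' := T.indep (mem_cells.1 hK).1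
  tot' := by
    rw [Subtype.range_coe_subtype, Finset.setOfPred_mem]
    exact affineSpan_cell hK

theorem mem_hull_iff_coord (hK : K ∈ T.cells) (hs : s ⊆ K) :
    x ∈ hull s ↔ (∀ i, 0 ≤ (cellBasis hK).coord i x) ∧
      ∀ i : K, (i : E d) ∉ s → (cellBasis hK).coord i x = 0 := by
  have himage : (s : Set (E d)) = cellBasis hK '' {i | (i : E d) ∈ s} := by
    ext y
    exact ⟨fun hy => ⟨⟨y, hs hy⟩, hy, rfl⟩, by rintro ⟨i, hi, rfl⟩; exact hi⟩
  rw [hull, himage]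
  exact mem_convexHull_image_iff_coord _

theorem hull_cell_eq_convexHull_range (hK : K ∈ T.cells) :
    hull K = convexHull ℝ (range (cellBasis hK)) :=
  congrArg (convexHull ℝ) (Subtype.range_coe_subtype (p := (· ∈ K))).symm

theorem mem_hull_erase_iff [DecidableEq (E d)] (hK : K ∈ T.cells) (hs : s ⊆ K) (i : K) :
    x ∈ hull (s.erase i) ↔ x ∈ hull s ∧ (cellBasis hK).coord i x = 0 := by
  rw [mem_hull_iff_coord hK hs, mem_hull_iff_coord hK ((s.erase_subset _).trans hs)]
  simp only [Finset.mem_erase, SetLike.coe_eq_coe, ne_eq]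
  refine ⟨fun h => ⟨⟨h.1, fun j hj => h.2 j fun h' => hj h'.2⟩, h.2 i fun h' => h'.1 rfl⟩,
    fun h => ⟨h.1.1, fun j hj => ?_⟩⟩
  obtain rfl | hji := eq_or_ne j i
  · exact h.2
  · exact h.1.2 j fun hjs => hj ⟨hji, hjs⟩

theorem exists_facet_of_notMem_nhds (hK : K ∈ T.cells) (hxK : x ∈ hull K) (hx : hull K ∉ 𝓝 x) :
    ∃ F ∈ T.facets, K ∈ T.cellsAt F ∧ x ∈ hull F := by
  classical
  obtain ⟨hKf, hcard⟩ := mem_cells.1 hK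
  obtain ⟨i, hi⟩ : ∃ i, (cellBasis hK).coord i x ≤ 0 := by
    by_contra! hpos
    refine hx (mem_interior_iff_mem_nhds.1 ?_)
    rw [hull_cell_eq_convexHull_range hK, AffineBasis.interior_convexHull]
    exact hpos
  have hxF : x ∈ hull (K.erase i) := (mem_hull_erase_iff hK subset_rfl i).2
    ⟨hxK, hi.antisymm (((mem_hull_iff_coord hK subset_rfl).1 hxK).1 i)⟩
  have hF : K.erase i ∈ T.faces :=
    T.down_closed hKf (K.erase_subset _) (hull_nonempty_iff.1 ⟨x, hxF⟩)
  refine ⟨K.erase i, mem_facets.2 ⟨hF, ?_⟩, mem_cellsAt.2 ⟨hK, K.erase_subset _⟩, hxF⟩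
  rw [Finset.card_erase_of_mem i.2, hcard, Nat.add_sub_cancel]

end Cells

section Skeleton

variable (T) in
/-- The affine hulls of the faces of codimension at least two: at a point off all of them the mesh
is locally either a single cell or a configuration of cells around one facet. -/
def skeleton : Set (AffineSubspace ℝ (E d)) :=
  (fun s : Finset (E d) => affineSpan ℝ (s : Set (E d))) '' {s ∈ T.faces | s.card < d}

variable (T) in
theorem finite_skeleton : T.skeleton.Finite := (T.finite_faces.subset (sep_subset _ _)).image _

theorem finrank_direction_skeleton {A : AffineSubspace ℝ (E d)} (hA : A ∈ T.skeleton) :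
    finrank ℝ A.direction + 2 ≤ d := by
  obtain ⟨s, ⟨hs, hcard⟩, rfl⟩ := hA
  have := finrank_direction_face hs
  simp only
  omega

variable (T) in
theorem measure_skeleton : μHE[d - 1] (⋃ A ∈ T.skeleton, (A : Set (E d))) = 0 := by
  refine (measure_biUnion_null_iff T.finite_skeleton.countable).2 fun A hA =>
    euclideanHausdorffMeasure_affineSubspace_eq_zero ?_
  have := finrank_direction_skeleton hA
  omega

theorem le_card_of_mem_hull (hx : ∀ A ∈ T.skeleton, x ∉ A) (hs : s ∈ T.faces) (hxs : x ∈ hull s) :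
    d ≤ s.card := by
  by_contra! hlt
  exact hx _ ⟨s, ⟨hs, hlt⟩, rfl⟩ (hull_subset_affineSpan hxs)

theorem finrank_direction_facet (hF : F ∈ T.facets) :
    finrank ℝ (affineSpan ℝ (F : Set (E d))).direction = d - 1 := by
  obtain ⟨hFf, hcard⟩ := mem_facets.1 hF
  have := finrank_direction_face hFf
  omega

theorem measure_hull_lt_top (hF : F ∈ T.facets) : μHE[d - 1] (hull F) < ⊤ := by
  rw [← finrank_direction_facet hF]
  exact euclideanHausdorffMeasure_lt_top_of_subset_affineSubspace hull_subset_affineSpan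
    isCompact_hull.isBounded

theorem measure_hull_pos (hF : F ∈ T.facets) : 0 < μHE[d - 1] (hull F) := by
  rw [← finrank_direction_facet hF, ← affineSpan_hull]
  exact euclideanHausdorffMeasure_pos_of_convex convex_hull
    (hull_nonempty_iff.2 (T.nonempty_of_mem_faces (mem_facets.1 hF).1))

theorem exists_mem_hull_notMem_skeleton (hF : F ∈ T.facets) :
    ∃ x ∈ hull F, ∀ A ∈ T.skeleton, x ∉ A := by
  by_contra! hsub
  refine (measure_hull_pos hF).ne' (measure_mono_null (fun x hx => ?_) T.measure_skeleton)
  obtain ⟨A, hA, hxA⟩ := hsub x hx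
  exact mem_biUnion hA hxA

end Skeleton

section FaceEquation

/-- `p` is an equation of the face `F` of the simplex `K`: it vanishes on `F` and is positive at the
other vertices of `K`. -/
structure IsFaceEquation (K F : Finset (E d)) (p : E d →ᵃ[ℝ] ℝ) : Prop where
  eq_zero : ∀ x ∈ F, p x = 0
  pos : ∀ x ∈ K, x ∉ F → 0 < p x

variable {p q : E d →ᵃ[ℝ] ℝ}

theorem IsFaceEquation.eq_zero_of_mem_hull (hp : IsFaceEquation K F p) (hx : x ∈ hull F) :
    p x = 0 :=
  p.eqOn_affineSpan (g := 0) hp.eq_zero (hull_subset_affineSpan hx)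

theorem exists_insert_eq_of_mem_cellsAt [DecidableEq (E d)] (hF : F ∈ T.facets)
    (hK : K ∈ T.cellsAt F) : ∃ a ∉ F, insert a F = K := by
  obtain ⟨hKc, hFK⟩ := mem_cellsAt.1 hK
  obtain ⟨a, ha⟩ := Finset.exists_eq_insert_iff.2
    ⟨hFK, by rw [(mem_facets.1 hF).2, (mem_cells.1 hKc).2]⟩
  exact ⟨a, ha⟩

theorem IsFaceEquation.ne_zero (hF : F ∈ T.facets) (hK : K ∈ T.cellsAt F)
    (hp : IsFaceEquation K F p) : p ≠ 0 := by
  classical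
  obtain ⟨a, ha, rfl⟩ := exists_insert_eq_of_mem_cellsAt hF hK
  rintro rfl
  exact (hp.pos a (F.mem_insert_self a) ha).ne' rfl

theorem IsFaceEquation.exists_eq_smul (hF : F ∈ T.facets) (hK : K ∈ T.cellsAt F)
    (hp : IsFaceEquation K F p) (hq : ∀ x ∈ F, q x = 0) : ∃ c : ℝ, q = c • p := by
  classical
  obtain ⟨a, ha, rfl⟩ := exists_insert_eq_of_mem_cellsAt hF hK
  have hpa := hp.pos a (F.mem_insert_self a) ha
  refine ⟨q a / p a, affineMap_eq_of_eqOn_cell (mem_cellsAt.1 hK).1 fun x hx => ?_⟩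
  rcases Finset.mem_insert.1 hx with rfl | hxF
  · simp [hpa.ne']
  · simp [hq x hxF, hp.eq_zero x hxF]

theorem exists_coord_isFaceEquation (hF : F ∈ T.facets) (hK : K ∈ T.cellsAt F) :
    ∃ a : K, (a : E d) ∉ F ∧ (∀ j ≠ a, (j : E d) ∈ F) ∧
      IsFaceEquation K F ((cellBasis (mem_cellsAt.1 hK).1).coord a) := by
  classical
  obtain ⟨a, ha, rfl⟩ := exists_insert_eq_of_mem_cellsAt hF hK
  let b := cellBasis (mem_cellsAt.1 hK).1
  have hmem : ∀ j : (insert a F : Finset (E d)), j ≠ ⟨a, F.mem_insert_self a⟩ → (j : E d) ∈ F :=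
    fun j hj => (Finset.mem_insert.1 j.2).resolve_left fun h => hj (Subtype.ext h)
  refine ⟨⟨a, F.mem_insert_self a⟩, ha, hmem, fun x hx => ?_, fun x hx hxF => ?_⟩
  · exact b.coord_apply_ne (j := ⟨x, Finset.mem_insert_of_mem hx⟩) (by grind)
  · obtain rfl := (Finset.mem_insert.1 hx).resolve_right hxF
    exact zero_lt_one.trans_eq (b.coord_apply_eq ⟨x, hx⟩).symm

theorem exists_isFaceEquation (hF : F ∈ T.facets) (hK : K ∈ T.cellsAt F) :
    ∃ p, IsFaceEquation K F p := by
  obtain ⟨a, -, -, ha⟩ := exists_coord_isFaceEquation hF hK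
  exact ⟨_, ha⟩

theorem IsFaceEquation.eventually_mem_hull_iff (hF : F ∈ T.facets) (hK : K ∈ T.cellsAt F)
    (hp : IsFaceEquation K F p) (hxF : x ∈ hull F) (hx : ∀ A ∈ T.skeleton, x ∉ A) :
    ∀ᶠ y in 𝓝 x, y ∈ hull K ↔ 0 ≤ p y := by
  classical
  obtain ⟨hKc, hFK⟩ := mem_cellsAt.1 hK
  obtain ⟨hFf, hcard⟩ := mem_facets.1 hF
  obtain ⟨a, haF, hne, ha⟩ := exists_coord_isFaceEquation hF hK
  obtain ⟨c, hc⟩ := hp.exists_eq_smul hF hK ha.eq_zero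
  have hcpos : 0 < c := by
    have hca := ha.pos a a.2 haF
    rw [hc] at hca
    exact pos_of_mul_pos_left hca (hp.pos a a.2 haF).le
  have hcoord : ∀ j ≠ a, 0 < (cellBasis hKc).coord j x := by
    intro j hj
    refine (((mem_hull_iff_coord hKc hFK).1 hxF).1 j).lt_of_ne' fun h0 => ?_
    have hxe : x ∈ hull (F.erase j) := (mem_hull_erase_iff hKc hFK j).2 ⟨hxF, h0⟩
    have hface := T.down_closed hFf (F.erase_subset _) (hull_nonempty_iff.1 ⟨x, hxe⟩)
    have := le_card_of_mem_hull hx hface hxe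
    have := Finset.card_erase_lt_of_mem (hne j hj)
    omega
  filter_upwards [eventually_mem_convexHull_range_iff _ hcoord] with y hy
  rw [hull_cell_eq_convexHull_range hKc, hy, hc]
  exact mul_nonneg_iff_of_pos_left hcpos

theorem IsFaceEquation.eventually_mem_hull_iff_of_ne (hF : F ∈ T.facets) (hK : K ∈ T.cellsAt F)
    (hK' : K' ∈ T.cellsAt F) (hne : K ≠ K') (hp : IsFaceEquation K F p) (hxF : x ∈ hull F)
    (hx : ∀ A ∈ T.skeleton, x ∉ A) : ∀ᶠ y in 𝓝 x, y ∈ hull K' ↔ p y ≤ 0 := by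
  classical
  obtain ⟨q, hq⟩ := exists_isFaceEquation hF hK'
  obtain ⟨c, rfl⟩ := hq.exists_eq_smul hF hK' hp.eq_zero
  have hKF := hp.eventually_mem_hull_iff hF hK hxF hx
  have hKF' := hq.eventually_mem_hull_iff hF hK' hxF hx
  have hinter : K ∩ K' ⊆ F := by
    obtain ⟨a, -, rfl⟩ := exists_insert_eq_of_mem_cellsAt hF hK
    obtain ⟨b, -, rfl⟩ := exists_insert_eq_of_mem_cellsAt hF hK'
    grind
  -- Otherwise the two cells would coincide near `x`, while they only meet in `F`.
  have hc : c < 0 := by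
    by_contra! hc
    obtain ⟨y, hy, hyK, hyK'⟩ := ((frequently_affineMap_pos (hq.ne_zero hF hK')
      (hq.eq_zero_of_mem_hull hxF)).and_eventually (hKF.and hKF')).exists
    have hyF : y ∈ hull F := hull_mono hinter (mem_hull_inter
      (mem_cells.1 (mem_cellsAt.1 hK).1).1 (mem_cells.1 (mem_cellsAt.1 hK').1).1
      (hyK.2 (mul_nonneg hc hy.le)) (hyK'.2 hy.le))
    exact hy.ne' (hq.eq_zero_of_mem_hull hyF)
  filter_upwards [hKF'] with y hy
  rw [hy, AffineMap.coe_smul, Pi.smul_apply, smul_eq_mul]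
  exact ⟨mul_nonpos_of_nonpos_of_nonneg hc.le, fun h => nonneg_of_mul_nonpos_right h hc⟩

end FaceEquation

section LocalStructure

variable {L : Finset (E d)} {p : E d →ᵃ[ℝ] ℝ}

theorem hull_union_hull_mem_nhds (hF : F ∈ T.facets) (hK : K ∈ T.cellsAt F) (hK' : K' ∈ T.cellsAt F)
    (hne : K ≠ K') (hxF : x ∈ hull F) (hx : ∀ A ∈ T.skeleton, x ∉ A) :
    hull K ∪ hull K' ∈ 𝓝 x := by
  obtain ⟨p, hp⟩ := exists_isFaceEquation hF hK
  filter_upwards [hp.eventually_mem_hull_iff hF hK hxF hx,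
    hp.eventually_mem_hull_iff_of_ne hF hK hK' hne hxF hx] with y hyK hyK'
  exact (le_total 0 (p y)).imp hyK.2 hyK'.2

theorem card_cellsAt_le_two (hF : F ∈ T.facets) : (T.cellsAt F).card ≤ 2 := by
  by_contra! hcard
  obtain ⟨K₁, K₂, K₃, h₁, h₂, h₃, h₁₂, h₁₃, h₂₃⟩ := Finset.two_lt_card_iff.1 hcard
  obtain ⟨x, hxF, hx⟩ := exists_mem_hull_notMem_skeleton hF
  obtain ⟨p, hp⟩ := exists_isFaceEquation hF h₁
  obtain ⟨q, hq⟩ := exists_isFaceEquation hF h₂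
  -- Near `x`, both `K₂` and `K₃` fill the half-space opposite to `K₁`, so they are on the same side
  -- of `F`; but they are distinct cells at `F`, so they must be on opposite sides.
  obtain ⟨y, hy, hp₂, hp₃, hq₂, hq₃⟩ := ((frequently_affineMap_pos (hq.ne_zero hF h₂)
    (hq.eq_zero_of_mem_hull hxF)).and_eventually
      ((hp.eventually_mem_hull_iff_of_ne hF h₁ h₂ h₁₂ hxF hx).and
      ((hp.eventually_mem_hull_iff_of_ne hF h₁ h₃ h₁₃ hxF hx).and
      ((hq.eventually_mem_hull_iff hF h₂ hxF hx).and
      (hq.eventually_mem_hull_iff_of_ne hF h₂ h₃ h₂₃ hxF hx))))).exists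
  exact hy.not_ge (hq₃.1 (hp₃.2 (hp₂.1 (hq₂.2 hy.le))))

variable (T) in
theorem eventually_exists_cell (x : E d) :
    ∀ᶠ y in 𝓝 x, y ∈ closure Ω → ∃ L ∈ T.cells, x ∈ hull L ∧ y ∈ hull L := by
  have hfar : ∀ᶠ y in 𝓝 x, ∀ L ∈ T.cells, x ∉ hull L → y ∉ hull L := by
    refine (eventually_all_finset _).2 fun L _ => ?_
    by_cases hxL : x ∈ hull L
    · simp [hxL]
    · filter_upwards [isCompact_hull.isClosed.isOpen_compl.mem_nhds hxL] with y hy _ using hy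
  filter_upwards [hfar] with y hy hyΩ
  obtain ⟨L, hL, hyL⟩ := T.exists_mem_hull_cell hyΩ
  exact ⟨L, hL, not_not.1 fun hxL => hy L hL hxL hyL, hyL⟩

theorem subset_of_mem_hull_of_mem_hull (hF : F ∈ T.facets) (hL : L ∈ T.cells) (hxF : x ∈ hull F)
    (hxL : x ∈ hull L) (hx : ∀ A ∈ T.skeleton, x ∉ A) : F ⊆ L := by
  classical
  obtain ⟨hFf, hcard⟩ := mem_facets.1 hF
  have hxI := mem_hull_inter hFf (mem_cells.1 hL).1 hxF hxL
  have hI := T.down_closed hFf Finset.inter_subset_left (hull_nonempty_iff.1 ⟨x, hxI⟩)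
  refine Finset.inter_eq_left.1 (Finset.eq_of_subset_of_card_le Finset.inter_subset_left ?_)
  exact hcard.trans_le (le_card_of_mem_hull hx hI hxI)

theorem exists_ne_mem_cellsAt (hF : F ∈ T.facets) (hK : K ∈ T.cellsAt F) (hxF : x ∈ hull F)
    (hx : ∀ A ∈ T.skeleton, x ∉ A) (hΩ : closure Ω ∈ 𝓝 x) : ∃ K' ∈ T.cellsAt F, K ≠ K' := by
  by_contra! honly
  obtain ⟨p, hp⟩ := exists_isFaceEquation hF hK
  obtain ⟨y, hy, hyK, hyL, hyΩ⟩ := ((frequently_affineMap_neg (hp.ne_zero hF hK)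
    (hp.eq_zero_of_mem_hull hxF)).and_eventually ((hp.eventually_mem_hull_iff hF hK hxF hx).and
      ((T.eventually_exists_cell x).and hΩ))).exists
  obtain ⟨L, hL, hxL, hyL⟩ := hyL hyΩ
  obtain rfl := honly L (mem_cellsAt.2 ⟨hL, subset_of_mem_hull_of_mem_hull hF hL hxF hxL hx⟩)
  exact hy.not_ge (hyK.1 hyL)

theorem hull_mem_nhds_or_exists_interiorFacet (hΩ : closure Ω ∈ 𝓝 x)
    (hx : ∀ A ∈ T.skeleton, x ∉ A) : (∃ K ∈ T.cells, hull K ∈ 𝓝 x) ∨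
      ∃ F ∈ T.interiorFacets, ∃ K ∈ T.cellsAt F, ∃ K' ∈ T.cellsAt F, K ≠ K' ∧ x ∈ hull F := by
  obtain ⟨K, hK, hxK⟩ := T.exists_mem_hull_cell (mem_of_mem_nhds hΩ)
  refine or_iff_not_imp_left.2 fun hnhds => ?_
  push Not at hnhds
  obtain ⟨F, hF, hKF, hxF⟩ := exists_facet_of_notMem_nhds hK hxK (hnhds K hK)
  obtain ⟨K', hKF', hne⟩ := exists_ne_mem_cellsAt hF hKF hxF hx hΩ
  refine ⟨F, mem_interiorFacets.2 ⟨hF, (card_cellsAt_le_two hF).antisymm ?_⟩,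
    K, hKF, K', hKF', hne, hxF⟩
  exact Finset.one_lt_card.2 ⟨K, hKF, K', hKF', hne⟩

end LocalStructure

end Triangulation

section Boundary

variable {Ω S : Set (E d)} {T : Triangulation Ω} {F K : Finset (E d)} {x : E d}

theorem IsDomainSet.isOpen (hΩ : IsDomainSet Ω) : IsOpen Ω := hΩ.regular ▸ isOpen_interior

theorem IsDomainSet.closure_notMem_nhds (hΩ : IsDomainSet Ω) (hx : x ∈ frontier Ω) :
    closure Ω ∉ 𝓝 x := fun h =>
  hx.2 (by rw [hΩ.isOpen.interior_eq, ← hΩ.regular]; exact mem_interior_iff_mem_nhds.2 h)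

namespace Triangulation

theorem exists_facet_of_mem_frontier (T : Triangulation Ω) (hΩ : IsDomainSet Ω)
    (hx : x ∈ frontier Ω) : ∃ F ∈ T.facets, ∃ K ∈ T.cellsAt F, x ∈ hull F := by
  obtain ⟨K, hK, hxK⟩ := T.exists_mem_hull_cell hx.1
  obtain ⟨F, hF, hKF, hxF⟩ := exists_facet_of_notMem_nhds hK hxK fun h =>
    hΩ.closure_notMem_nhds hx (mem_of_superset h (hull_subset_closure hK))
  exact ⟨F, hF, K, hKF, hxF⟩

theorem exists_boundaryFacet_of_mem_frontier (hΩ : IsDomainSet Ω) (hx : x ∈ frontier Ω)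
    (hskel : ∀ A ∈ T.skeleton, x ∉ A) : ∃ F ∈ T.boundaryFacets, x ∈ hull F := by
  obtain ⟨F, hF, K, hK, hxF⟩ := T.exists_facet_of_mem_frontier hΩ hx
  refine ⟨F, mem_boundaryFacets.2 ⟨hF, Finset.card_eq_one.2 ⟨K, ?_⟩⟩, hxF⟩
  refine Finset.eq_singleton_iff_unique_mem.2 ⟨hK, fun K' hK' => ?_⟩
  by_contra! hne
  refine hΩ.closure_notMem_nhds hx (mem_of_superset
    (hull_union_hull_mem_nhds hF hK hK' hne.symm hxF hskel) (union_subset ?_ ?_))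
  · exact hull_subset_closure (mem_cellsAt.1 hK).1
  · exact hull_subset_closure (mem_cellsAt.1 hK').1

theorem measure_frontier_lt_top (T : Triangulation Ω) (hΩ : IsDomainSet Ω) :
    μHE[d - 1] (frontier Ω) < ⊤ := by
  have hsub : frontier Ω ⊆ ⋃ F ∈ T.facets, hull F := fun x hx => by
    obtain ⟨F, hF, -, -, hxF⟩ := T.exists_facet_of_mem_frontier hΩ hx
    exact mem_biUnion hF hxF
  exact (measure_mono hsub).trans_lt
    (measure_biUnion_lt_top T.facets.finite_toSet fun F hF => measure_hull_lt_top hF)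

theorem exists_boundaryFacet_measure_inter_pos (T : Triangulation Ω) (hΩ : IsDomainSet Ω)
    (hS : S ⊆ frontier Ω) (hpos : 0 < μHE[d - 1] S) :
    ∃ F ∈ T.boundaryFacets, 0 < μHE[d - 1] (hull F ∩ S) := by
  by_contra! hnull
  refine hpos.ne' (measure_mono_null (t := (⋃ A ∈ T.skeleton, (A : Set (E d))) ∪
    ⋃ F ∈ T.boundaryFacets, hull F ∩ S) (fun x hx => ?_) ?_)
  · by_cases hskel : ∀ A ∈ T.skeleton, x ∉ A
    · obtain ⟨F, hF, hxF⟩ := exists_boundaryFacet_of_mem_frontier hΩ (hS hx) hskel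
      exact Or.inr (mem_biUnion hF ⟨hxF, hx⟩)
    · push Not at hskel
      obtain ⟨A, hA, hxA⟩ := hskel
      exact Or.inl (mem_biUnion hA hxA)
  · refine measure_union_null T.measure_skeleton ?_
    exact (measure_biUnion_null_iff T.boundaryFacets.countable_toSet).2
      fun F hF => nonpos_iff_eq_zero.1 (hnull F hF)

theorem isOuterNormal_outerNormal (hF : F ∈ T.facets) (hK : K ∈ T.cellsAt F) :
    IsOuterNormal K F (outerNormal K F) := by
  obtain ⟨p, hp⟩ := exists_isFaceEquation hF hK
  obtain ⟨a, ha⟩ := T.nonempty_of_mem_faces (mem_facets.1 hF).1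
  have hgrad : affineGrad p ≠ 0 := fun h => hp.ne_zero hF hK
    (affineMap_eq_of_affineGrad_eq (x := a) (h.trans (map_zero _).symm) (hp.eq_zero a ha))
  have hinner : ∀ x y, ⟪-(‖affineGrad p‖⁻¹ • affineGrad p), y - x⟫_ℝ
      = ‖affineGrad p‖⁻¹ * (p x - p y) := fun x y => by
    rw [inner_neg_left, real_inner_smul_left, inner_affineGrad_sub]
    ring
  refine Classical.epsilon_spec (p := IsOuterNormal K F)
    ⟨-(‖affineGrad p‖⁻¹ • affineGrad p), ?_, fun x hx y hy => ?_, fun x hx y hy => ?_⟩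
  · rw [norm_neg, norm_smul, norm_inv, norm_norm, inv_mul_cancel₀ (norm_ne_zero_iff.2 hgrad)]
  · rw [hinner, hp.eq_zero x hx, hp.eq_zero y hy, sub_zero, mul_zero]
  · have hpy : 0 ≤ p y := by
      by_cases hyF : y ∈ F
      · exact (hp.eq_zero y hyF).ge
      · exact (hp.pos y hy hyF).le
    rw [hinner, hp.eq_zero x hx, zero_sub]
    exact mul_nonpos_of_nonneg_of_nonpos (by positivity) (neg_nonpos.2 hpy)

end Triangulation

end Boundary

section DiscreteSpace

variable {Ω : Set (E d)} {T : Triangulation Ω} {K : Finset (E d)} {x : E d}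

namespace Triangulation

theorem P1_ext {u v : T.P1} (h : EqOn (u : E d → ℝ) v (closure Ω)) : u = v := by
  ext x
  by_cases hx : x ∈ closure Ω
  · exact h hx
  · exact (u.2.2.1 x hx).trans (v.2.2.1 x hx).symm

open Classical in
/-- The affine function with which a discrete function coincides on the cell `K`, depending linearly
on the discrete function. If `K` is not a cell, the value is `0`. -/
def cellAffine (T : Triangulation Ω) (K : Finset (E d)) : T.P1 →ₗ[ℝ] E d →ᵃ[ℝ] ℝ :=
  if hK : K ∈ T.cells then
    { toFun := fun v => (v.2.2.2 K hK).choose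
      map_add' := fun u v => affineMap_eq_of_eqOn_cell hK fun x hx => by
        have hxK := subset_hull hx
        have h := ((u + v).2.2.2 K hK).choose_spec hxK
        simpa [(u.2.2.2 K hK).choose_spec hxK, (v.2.2.2 K hK).choose_spec hxK] using h.symm
      map_smul' := fun c v => affineMap_eq_of_eqOn_cell hK fun x hx => by
        have hxK := subset_hull hx
        have h := ((c • v).2.2.2 K hK).choose_spec hxK
        simpa [(v.2.2.2 K hK).choose_spec hxK] using h.symm }
  else 0

theorem eqOn_cellAffine (hK : K ∈ T.cells) (v : T.P1) :
    EqOn (v : E d → ℝ) (T.cellAffine K v) (hull K) := by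
  simpa [cellAffine, hK] using (v.2.2.2 K hK).choose_spec

theorem cellAffine_eq (hK : K ∈ T.cells) {v : T.P1} {p : E d →ᵃ[ℝ] ℝ}
    (hv : EqOn (v : E d → ℝ) p (hull K)) : T.cellAffine K v = p :=
  affineMap_eq_of_eqOn_cell hK fun _ hx =>
    (eqOn_cellAffine hK v (subset_hull hx)).symm.trans (hv (subset_hull hx))

instance : FiniteDimensional ℝ T.P1 := by
  refine FiniteDimensional.of_injective (LinearMap.pi fun K : T.cells => T.cellAffine K.1)
    fun u v huv => P1_ext fun x hx => ?_
  obtain ⟨K, hK, hxK⟩ := T.exists_mem_hull_cell hx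
  rw [eqOn_cellAffine hK u hxK, eqOn_cellAffine hK v hxK]
  exact congrArg (· x) (congrFun huv ⟨K, hK⟩)

/-- The constant value of the gradient of a discrete function on the cell `K`. -/
def cellGrad (T : Triangulation Ω) (K : Finset (E d)) : T.P1 →ₗ[ℝ] E d :=
  affineGrad ∘ₗ T.cellAffine K

theorem grad_eq_cellGrad (hK : K ∈ T.cells) (v : T.P1) (hx : x ∈ hull K) :
    grad K v x = T.cellGrad K v :=
  gradientWithin_eq_of_eqOn_affineMap (uniqueDiffOn_hull hK) (eqOn_cellAffine hK v) hx

theorem lap_eq_zero (hK : K ∈ T.cells) (v : T.P1) (hx : x ∈ hull K) : lap K v x = 0 :=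
  laplacianWithin_eq_zero_of_eqOn_affineMap (uniqueDiffOn_hull hK) (eqOn_cellAffine hK v) hx

end Triangulation

end DiscreteSpace

section PosSemidef

open LinearMap (BilinForm)

variable {ι M M' W : Type*} [AddCommGroup M] [Module ℝ M] [AddCommGroup M'] [Module ℝ M']
  [NormedAddCommGroup W] [InnerProductSpace ℝ W]

theorem mem_ker_iff_of_isPosSemidef {B : BilinForm ℝ M} (hB : B.IsPosSemidef) {x : M} :
    x ∈ LinearMap.ker B ↔ B x x = 0 :=
  (B.apply_apply_same_eq_zero_iff hB.nonneg ⟨hB.eq⟩).symm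

theorem isPosSemidef_sum {s : Finset ι} {B : ι → BilinForm ℝ M}
    (hB : ∀ i ∈ s, (B i).IsPosSemidef) : (∑ i ∈ s, B i).IsPosSemidef :=
  Finset.sum_induction _ _ (fun _ _ => .add) LinearMap.BilinForm.isPosSemidef_zero hB

theorem mem_ker_of_mem_ker_sum {s : Finset ι} {B : ι → BilinForm ℝ M}
    (hB : ∀ i ∈ s, (B i).IsPosSemidef) {x : M} (hx : x ∈ LinearMap.ker (∑ i ∈ s, B i)) :
    ∀ i ∈ s, x ∈ LinearMap.ker (B i) := by
  rw [mem_ker_iff_of_isPosSemidef (isPosSemidef_sum hB)] at hx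
  simp only [LinearMap.sum_apply] at hx
  intro i hi
  rw [mem_ker_iff_of_isPosSemidef (hB i hi)]
  exact (Finset.sum_eq_zero_iff_of_nonneg fun j hj => (hB j hj).nonneg x).1 hx i hi

theorem mem_ker_of_mem_ker_add {B C : BilinForm ℝ M} (hB : B.IsPosSemidef) (hC : C.IsPosSemidef)
    {x : M} (hx : x ∈ LinearMap.ker (B + C)) : x ∈ LinearMap.ker B ∧ x ∈ LinearMap.ker C := by
  rw [mem_ker_iff_of_isPosSemidef (hB.add hC)] at hx
  rw [mem_ker_iff_of_isPosSemidef hB, mem_ker_iff_of_isPosSemidef hC]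
  exact (add_eq_zero_iff_of_nonneg (hB.nonneg x) (hC.nonneg x)).1 hx

theorem isPosSemidef_comp {B : BilinForm ℝ M'} (hB : B.IsPosSemidef) (f : M →ₗ[ℝ] M') :
    (B.comp f f).IsPosSemidef where
  eq x y := hB.eq (f x) (f y)
  nonneg x := hB.nonneg (f x)

theorem mem_ker_comp_iff {B : BilinForm ℝ M'} (hB : B.IsPosSemidef) {f : M →ₗ[ℝ] M'} {x : M} :
    x ∈ LinearMap.ker (B.comp f f) ↔ f x ∈ LinearMap.ker B := by
  rw [mem_ker_iff_of_isPosSemidef (isPosSemidef_comp hB f), mem_ker_iff_of_isPosSemidef hB]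
  rfl

/-- The positive semidefinite form `(x, y) ↦ c ⟪f x, f y⟫` with weight `c`: every term of the
stabilisation is of this kind. -/
def gramForm (c : ℝ) (f : M →ₗ[ℝ] W) : BilinForm ℝ M := c • BilinForm.comp (innerₗ W) f f

theorem gramForm_apply (c : ℝ) (f : M →ₗ[ℝ] W) (x y : M) :
    gramForm c f x y = c * ⟪f x, f y⟫_ℝ := rfl

theorem isPosSemidef_gramForm {c : ℝ} (hc : 0 ≤ c) (f : M →ₗ[ℝ] W) :
    (gramForm c f).IsPosSemidef :=
  (isPosSemidef_comp (LinearMap.BilinForm.isPosSemidef_iff.2 isPosSemidef_inner) f).smul hc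

theorem mem_ker_gramForm_iff {c : ℝ} (hc : 0 < c) {f : M →ₗ[ℝ] W} {x : M} :
    x ∈ LinearMap.ker (gramForm c f) ↔ f x = 0 := by
  rw [mem_ker_iff_of_isPosSemidef (isPosSemidef_gramForm hc.le f), gramForm_apply,
    mul_eq_zero_iff_left hc.ne', inner_self_eq_zero]

end PosSemidef

section StabilisationForms

open LinearMap (BilinForm)

variable {Ω : Set (E d)} {T : Triangulation Ω} {γ₁ γ₂ : Finset (E d) → ℝ} {μ : ℝ} {B : WeakBC Ω}
  {F K K' : Finset (E d)} {u : T.P1}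

open Triangulation

/-- The interior penalty form on `T.P1`. There is no contribution of `γ₂`, since the Laplacian of a
discrete function vanishes on every cell. -/
def scipForm (T : Triangulation Ω) (γ₁ : Finset (E d) → ℝ) : BilinForm ℝ T.P1 :=
  ∑ F ∈ T.interiorFacets, ∑ q ∈ (T.cellsAt F).offDiag,
    gramForm (1 / 2 * (μHE[d - 1].real (hull F) * (Metric.diam (hull F) * γ₁ F)))
      (T.cellGrad q.1 - T.cellGrad q.2)

theorem scipForm_apply (u v : T.P1) : scipForm T γ₁ u v = scip T γ₁ γ₂ u v := by
  simp only [scipForm, LinearMap.sum_apply, gramForm_apply, scip, Finset.mul_sum]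
  refine Finset.sum_congr rfl fun F _ => Finset.sum_congr rfl fun q hq => ?_
  obtain ⟨h₁, h₂, -⟩ := Finset.mem_offDiag.1 hq
  rw [mem_cellsAt] at h₁ h₂
  rw [setIntegral_congr_fun (g := fun _ => Metric.diam (hull F) * γ₁ F *
    ⟪T.cellGrad q.1 u - T.cellGrad q.2 u, T.cellGrad q.1 v - T.cellGrad q.2 v⟫_ℝ)
    isCompact_hull.measurableSet, setIntegral_const, smul_eq_mul, LinearMap.sub_apply,
    LinearMap.sub_apply]
  · ring
  · intro x hx
    have hx₁ := hull_mono h₁.2 hx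
    have hx₂ := hull_mono h₂.2 hx
    simp only [grad_eq_cellGrad h₁.1 _ hx₁, grad_eq_cellGrad h₂.1 _ hx₂, lap_eq_zero h₁.1 _ hx₁,
      lap_eq_zero h₂.1 _ hx₂, sub_zero, mul_zero, add_zero]

theorem isPosSemidef_scipForm (hγ₁ : ∀ F ∈ T.interiorFacets, 0 < γ₁ F) :
    (scipForm T γ₁).IsPosSemidef :=
  isPosSemidef_sum fun F hF => isPosSemidef_sum fun _ _ => isPosSemidef_gramForm
    (by have := hγ₁ F hF; positivity) _

theorem cellGrad_eq_of_mem_ker_scipForm (hd : 2 ≤ d) (hγ₁ : ∀ F ∈ T.interiorFacets, 0 < γ₁ F)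
    (hu : u ∈ LinearMap.ker (scipForm T γ₁)) (hF : F ∈ T.interiorFacets) (hK : K ∈ T.cellsAt F)
    (hK' : K' ∈ T.cellsAt F) (hne : K ≠ K') : T.cellGrad K u = T.cellGrad K' u := by
  obtain ⟨hFf, -⟩ := mem_interiorFacets.1 hF
  have hγF := hγ₁ F hF
  have hdiam : 0 < Metric.diam (hull F) := diam_hull_pos (by rw [(mem_facets.1 hFf).2]; omega)
  have hmeas : 0 < μHE[d - 1].real (hull F) :=
    ENNReal.toReal_pos (measure_hull_pos hFf).ne' (measure_hull_lt_top hFf).ne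
  have hF' := mem_ker_of_mem_ker_sum (fun F hF => isPosSemidef_sum fun _ _ =>
    isPosSemidef_gramForm (by have := hγ₁ F hF; positivity) _) hu F hF
  have hKK' := mem_ker_of_mem_ker_sum (fun _ _ => isPosSemidef_gramForm (by positivity) _) hF'
    (K, K') (Finset.mem_offDiag.2 ⟨hK, hK', hne⟩)
  exact sub_eq_zero.1 ((mem_ker_gramForm_iff (by positivity)).1 hKK')

/-- The derivative of a discrete function on the cell `K` in the direction of the outer normal to
the face `F`. -/
def normalDeriv (T : Triangulation Ω) (K F : Finset (E d)) : T.P1 →ₗ[ℝ] ℝ :=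
  innerₗ (E d) (outerNormal K F) ∘ₗ T.cellGrad K

theorem normalDeriv_apply (u : T.P1) :
    normalDeriv T K F u = ⟪outerNormal K F, T.cellGrad K u⟫_ℝ := rfl

/-- The Neumann penalty form on `T.P1`. -/
def neumannForm (T : Triangulation Ω) (B : WeakBC Ω) : BilinForm ℝ T.P1 :=
  ∑ F ∈ T.boundaryFacets, ∑ K ∈ T.cellsAt F,
    gramForm (μHE[d - 1].real (hull F ∩ B.ΓN) * (B.γN * T.meshSize)) (normalDeriv T K F)

theorem neumannForm_apply (u v : T.P1) : neumannForm T B u v = neumannPenalty T B u v := by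
  simp only [neumannForm, LinearMap.sum_apply, gramForm_apply, neumannPenalty]
  refine Finset.sum_congr rfl fun F _ => Finset.sum_congr rfl fun K hK => ?_
  rw [mem_cellsAt] at hK
  rw [setIntegral_congr_fun (g := fun _ => B.γN * T.meshSize *
    (normalDeriv T K F u * normalDeriv T K F v))
    (isCompact_hull.measurableSet.inter B.measurableSet_ΓN), setIntegral_const, smul_eq_mul,
    Real.inner_apply]
  · ring
  · intro x hx
    simp only [grad_eq_cellGrad hK.1 _ (hull_mono hK.2 hx.1), normalDeriv_apply, real_inner_comm]

theorem isPosSemidef_neumannForm (hh : 0 < T.meshSize) : (neumannForm T B).IsPosSemidef :=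
  isPosSemidef_sum fun _ _ => isPosSemidef_sum fun _ _ => isPosSemidef_gramForm
    (by have := B.γN_pos; positivity) _

theorem normalDeriv_eq_zero_of_mem_ker_neumannForm (hh : 0 < T.meshSize)
    (hu : u ∈ LinearMap.ker (neumannForm T B)) (hF : F ∈ T.boundaryFacets)
    (hpos : 0 < μHE[d - 1] (hull F ∩ B.ΓN)) (hK : K ∈ T.cellsAt F) : normalDeriv T K F u = 0 := by
  have hγN := B.γN_pos
  have hfin : μHE[d - 1] (hull F ∩ B.ΓN) < ⊤ := (measure_mono inter_subset_left).trans_lt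
    (measure_hull_lt_top (mem_boundaryFacets.1 hF).1)
  have hmeas : 0 < μHE[d - 1].real (hull F ∩ B.ΓN) := ENNReal.toReal_pos hpos.ne' hfin.ne
  have hF' := mem_ker_of_mem_ker_sum (fun _ _ => isPosSemidef_sum fun _ _ =>
    isPosSemidef_gramForm (by positivity) _) hu F hF
  have hK' := mem_ker_of_mem_ker_sum (fun _ _ => isPosSemidef_gramForm (by positivity) _) hF' K hK
  exact (mem_ker_gramForm_iff (by positivity)).1 hK'

theorem memLp_restrict_ΓD (hΩ : IsDomainSet Ω) (B : WeakBC Ω) (v : T.P1) :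
    MemLp (v : E d → ℝ) 2 (μHE[d - 1].restrict B.ΓD) := by
  have hsub : B.ΓD ⊆ closure Ω := B.ΓD_subset.trans frontier_subset_closure
  have hfin := (measure_mono B.ΓD_subset).trans_lt (T.measure_frontier_lt_top hΩ)
  have : IsFiniteMeasure (μHE[d - 1].restrict B.ΓD) := isFiniteMeasure_restrict.2 hfin.ne
  obtain ⟨C, hC⟩ := T.isCompact_closure.exists_bound_of_continuousOn v.2.1
  refine MemLp.of_bound ((v.2.1.mono hsub).aestronglyMeasurable B.measurableSet_ΓD) C ?_
  filter_upwards [ae_restrict_mem B.measurableSet_ΓD] with x hx using hC x (hsub hx)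

/-- The restriction of discrete functions to the Dirichlet part of the boundary, in `L²`. -/
def dirichletTrace (T : Triangulation Ω) (hΩ : IsDomainSet Ω) (B : WeakBC Ω) :
    T.P1 →ₗ[ℝ] Lp ℝ 2 (μHE[d - 1].restrict B.ΓD) where
  toFun v := (memLp_restrict_ΓD hΩ B v).toLp v
  map_add' _ _ := rfl
  map_smul' _ _ := rfl

/-- The Dirichlet penalty form on `T.P1`. -/
def dirichletForm (T : Triangulation Ω) (hΩ : IsDomainSet Ω) (μ : ℝ) (B : WeakBC Ω) :
    BilinForm ℝ T.P1 :=
  gramForm (B.γD * μ * T.meshSize⁻¹) (dirichletTrace T hΩ B)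

theorem dirichletForm_apply (hΩ : IsDomainSet Ω) (u v : T.P1) :
    dirichletForm T hΩ μ B u v = dirichletPenalty T μ B u v := by
  rw [dirichletForm, gramForm_apply, dirichletPenalty, integral_const_mul, L2.inner_def]
  congr 1
  refine integral_congr_ae ?_
  filter_upwards [(memLp_restrict_ΓD hΩ B u).coeFn_toLp, (memLp_restrict_ΓD hΩ B v).coeFn_toLp]
    with x hu hv
  exact (congrArg₂ (fun a b : ℝ => ⟪a, b⟫_ℝ) hu hv).trans (Real.inner_apply _ _)

theorem isPosSemidef_dirichletForm (hΩ : IsDomainSet Ω) (hh : 0 < T.meshSize) (hμ : 0 < μ) :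
    (dirichletForm T hΩ μ B).IsPosSemidef := by
  have hγD := B.γD_pos
  exact isPosSemidef_gramForm (by positivity) _

theorem ae_eq_zero_of_mem_ker_dirichletForm (hΩ : IsDomainSet Ω) (hh : 0 < T.meshSize)
    (hμ : 0 < μ) (hu : u ∈ LinearMap.ker (dirichletForm T hΩ μ B)) :
    (u : E d → ℝ) =ᵐ[μHE[d - 1].restrict B.ΓD] 0 := by
  have hγD := B.γD_pos
  have htrace : dirichletTrace T hΩ B u = 0 := (mem_ker_gramForm_iff (by positivity)).1 hu
  exact (memLp_restrict_ΓD hΩ B u).coeFn_toLp.symm.trans ((Lp.eq_zero_iff_ae_eq_zero).1 htrace)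

/-- The stabilisation as a bilinear form on `T.P1`. -/
def stabForm (T : Triangulation Ω) (hΩ : IsDomainSet Ω) (γ₁ : Finset (E d) → ℝ) (μ : ℝ)
    (B : WeakBC Ω) : BilinForm ℝ T.P1 :=
  scipForm T γ₁ + dirichletForm T hΩ μ B + neumannForm T B

theorem stabForm_apply (hΩ : IsDomainSet Ω) (u v : T.P1) :
    stabForm T hΩ γ₁ μ B u v = stab T γ₁ γ₂ μ B u v := by
  simp only [stabForm, stab, LinearMap.add_apply, scipForm_apply (γ₂ := γ₂), dirichletForm_apply,
    neumannForm_apply]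

theorem isPosSemidef_stabForm (hΩ : IsDomainSet Ω) (hh : 0 < T.meshSize)
    (hγ₁ : ∀ F ∈ T.interiorFacets, 0 < γ₁ F) (hμ : 0 < μ) :
    (stabForm T hΩ γ₁ μ B).IsPosSemidef :=
  ((isPosSemidef_scipForm hγ₁).add (isPosSemidef_dirichletForm hΩ hh hμ)).add
    (isPosSemidef_neumannForm hh)

theorem exists_affineMap_eqOn_of_mem_ker_scipForm (hd : 2 ≤ d) (hΩ : IsDomainSet Ω)
    (hγ₁ : ∀ F ∈ T.interiorFacets, 0 < γ₁ F) (hu : u ∈ LinearMap.ker (scipForm T γ₁)) :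
    ∃ p : E d →ᵃ[ℝ] ℝ, EqOn (u : E d → ℝ) p (closure Ω) := by
  have hloc : ∀ x ∈ Ω, (∀ A ∈ T.skeleton, x ∉ A) →
      ∃ p : E d →ᵃ[ℝ] ℝ, (u : E d → ℝ) =ᶠ[𝓝 x] p := by
    intro x hx hskel
    rcases hull_mem_nhds_or_exists_interiorFacet
      (mem_of_superset (hΩ.isOpen.mem_nhds hx) subset_closure) hskel with
      ⟨K, hK, hnhds⟩ | ⟨F, hF, K, hK, K', hK', hne, hxF⟩
    · exact ⟨_, (eqOn_cellAffine hK u).eventuallyEq_of_mem hnhds⟩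
    · have hKx := eqOn_cellAffine (mem_cellsAt.1 hK).1 u
      have hKx' := eqOn_cellAffine (mem_cellsAt.1 hK').1 u
      have heq : T.cellAffine K u = T.cellAffine K' u := affineMap_eq_of_affineGrad_eq
        (cellGrad_eq_of_mem_ker_scipForm hd hγ₁ hu hF hK hK' hne) (x := x)
        ((hKx (hull_mono (mem_cellsAt.1 hK).2 hxF)).symm.trans
          (hKx' (hull_mono (mem_cellsAt.1 hK').2 hxF)))
      exact ⟨_, (hKx.union (heq ▸ hKx')).eventuallyEq_of_mem
        (hull_union_hull_mem_nhds (mem_interiorFacets.1 hF).1 hK hK' hne hxF hskel)⟩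
  obtain ⟨p, hp⟩ := exists_affineMap_eqOn_of_isPreconnected hΩ.isOpen hΩ.connected.isPreconnected
    (u.2.1.mono subset_closure) T.finite_skeleton.countable
    (fun A hA => by simpa using finrank_direction_skeleton hA) hloc
  exact ⟨p, hp.of_subset_closure u.2.1 p.continuous_of_finiteDimensional.continuousOn
    subset_closure subset_rfl⟩

theorem exists_affineMap_and_boundary_conditions_of_mem_ker_stabForm (hd : 2 ≤ d)
    (hΩ : IsDomainSet Ω) (hγ₁ : ∀ F ∈ T.interiorFacets, 0 < γ₁ F) (hμ : 0 < μ)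
    (hu : u ∈ LinearMap.ker (stabForm T hΩ γ₁ μ B)) :
    (∃ p : E d →ᵃ[ℝ] ℝ, EqOn (u : E d → ℝ) p (closure Ω)) ∧
      (u : E d → ℝ) =ᵐ[μHE[d - 1].restrict B.ΓD] 0 ∧
      ∀ F ∈ T.boundaryFacets, 0 < μHE[d - 1] (hull F ∩ B.ΓN) →
        ∀ K ∈ T.cellsAt F, normalDeriv T K F u = 0 := by
  have hh : 0 < T.meshSize := T.meshSize_pos (by omega) hΩ.connected.nonempty
  have hscip := isPosSemidef_scipForm hγ₁
  have hdir := isPosSemidef_dirichletForm (B := B) hΩ hh hμ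
  obtain ⟨hsd, hN⟩ := mem_ker_of_mem_ker_add (hscip.add hdir) (isPosSemidef_neumannForm hh) hu
  obtain ⟨hS, hD⟩ := mem_ker_of_mem_ker_add hscip hdir hsd
  exact ⟨exists_affineMap_eqOn_of_mem_ker_scipForm hd hΩ hγ₁ hS,
    ae_eq_zero_of_mem_ker_dirichletForm hΩ hh hμ hD,
    fun _ hF hpos _ hK => normalDeriv_eq_zero_of_mem_ker_neumannForm hh hN hF hpos hK⟩

end StabilisationForms

section AffineZeros

variable {V : Type*} [NormedAddCommGroup V] [InnerProductSpace ℝ V] [FiniteDimensional ℝ V]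
  {A : AffineSubspace ℝ V} {p : V →ᵃ[ℝ] ℝ}

theorem eqOn_zero_of_euclideanHausdorffMeasure_pos [MeasurableSpace V] [BorelSpace V]
    (h : 0 < μHE[finrank ℝ A.direction] {x | x ∈ A ∧ p x = 0}) : EqOn p 0 A := by
  have hle : A ≤ (affineSpan ℝ {(0 : ℝ)}).comap p :=
    le_of_euclideanHausdorffMeasure_inter_pos (h.trans_le (measure_mono fun x hx =>
      ⟨hx.1, (AffineSubspace.mem_affineSpan_singleton ℝ ℝ).2 hx.2⟩))
  exact fun x hx => (AffineSubspace.mem_affineSpan_singleton ℝ ℝ).1 (hle hx)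

theorem affineGrad_mem_orthogonal_direction (hA : (A : Set V).Nonempty) (hp : EqOn p 0 A) :
    affineGrad p ∈ A.directionᗮ := by
  obtain ⟨x, hx⟩ := hA
  refine (Submodule.mem_orthogonal' _ _).2 fun w hw => ?_
  obtain ⟨y, hy, rfl⟩ := (AffineSubspace.mem_direction_iff_eq_vsub_right hx _).1 hw
  rw [vsub_eq_sub, inner_affineGrad_sub, hp hx, hp hy, Pi.zero_apply, Pi.zero_apply,
    sub_self]

end AffineZeros

section Sides

variable {Ω S : Set (E d)} {T : Triangulation Ω} {V : Submodule ℝ (E d → ℝ)} {B : WeakBC Ω}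
  {K F : Finset (E d)} {ν : E d} {u : T.P1} {p : E d →ᵃ[ℝ] ℝ}

open Triangulation

theorem finrank_orthogonal_span_singleton_of_norm_eq_one (hν : ‖ν‖ = 1) :
    finrank ℝ (ℝ ∙ ν)ᗮ = d - 1 := by
  have hν0 : ν ≠ 0 := norm_ne_zero_iff.1 (by rw [hν]; exact one_ne_zero)
  have h := (ℝ ∙ ν).finrank_add_finrank_orthogonal
  rw [finrank_span_singleton hν0, finrank_euclideanSpace_fin] at h
  omega

theorem IsSide.exists_affineSubspace (hS : IsSide Ω S ν) : ∃ A : AffineSubspace ℝ (E d),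
    A.direction = (ℝ ∙ ν)ᗮ ∧ S ⊆ A ∧ 0 < μHE[finrank ℝ A.direction] S := by
  obtain ⟨-, -, c, hc, x, hxS, r, hr, hball⟩ := hS
  have hmem : ∀ y, y ∈ AffineSubspace.mk' x (ℝ ∙ ν)ᗮ ↔ ⟪ν, y⟫_ℝ = c := fun y => by
    rw [AffineSubspace.mem_mk', Submodule.mem_orthogonal_singleton_iff_inner_right, vsub_eq_sub,
      inner_sub_right, hc x hxS, sub_eq_zero]
  refine ⟨_, AffineSubspace.direction_mk' _ _, fun y hy => (hmem y).2 (hc y hy), ?_⟩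
  refine (euclideanHausdorffMeasure_affineSubspace_inter_pos (AffineSubspace.self_mem_mk' _ _)
    (Metric.ball_mem_nhds x hr)).trans_le (measure_mono fun y hy => ?_)
  exact hball y hy.2 ((hmem y).1 hy.1)

theorem HasDirichletSide.exists_eqOn_zero (hside : HasDirichletSide V B ν) (huV : (u : E d → ℝ) ∈ V)
    (hu : (u : E d → ℝ) =ᵐ[μHE[d - 1].restrict B.ΓD] 0) (hp : EqOn (u : E d → ℝ) p (closure Ω)) :
    ∃ A : AffineSubspace ℝ (E d),
      A.direction = (ℝ ∙ ν)ᗮ ∧ (A : Set (E d)).Nonempty ∧ EqOn p 0 A := by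
  obtain ⟨S, hS, hDir⟩ := hside
  obtain ⟨A, hA, hSA, hpos⟩ := hS.exists_affineSubspace
  have hdim : finrank ℝ A.direction = d - 1 := by
    rw [hA, finrank_orthogonal_span_singleton_of_norm_eq_one hS.2.1]
  refine ⟨A, hA, (nonempty_of_measure_ne_zero hpos.ne').mono hSA,
    eqOn_zero_of_euclideanHausdorffMeasure_pos ?_⟩
  have hpu : ∀ y ∈ S, p y = u.1 y := fun y hy => (hp (frontier_subset_closure (hS.1 hy))).symm
  have hnull : μHE[d - 1] {y | ¬(y ∈ S → p y = 0)} = 0 := by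
    rcases hDir with hweak | hstrong
    · refine measure_mono_null (fun y hy => ?_)
        (ae_iff.1 ((ae_restrict_iff' B.measurableSet_ΓD).1 hu))
      exact fun h => hy fun hyS => (hpu y hyS).trans (h (hweak hyS))
    · refine measure_mono_null (fun y hy => ?_) measure_empty
      exact hy fun hyS => (hpu y hyS).trans (hstrong _ huV y hyS)
  rw [hdim] at hpos ⊢
  rw [← measure_sdiff_null hnull] at hpos
  exact hpos.trans_le (measure_mono fun y hy => ⟨hSA hy.1, not_not.1 hy.2 hy.1⟩)

theorem HasDirichletSide.exists_eq_zero_and_affineGrad_mem_span (hside : HasDirichletSide V B ν)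
    (huV : (u : E d → ℝ) ∈ V) (hu : (u : E d → ℝ) =ᵐ[μHE[d - 1].restrict B.ΓD] 0)
    (hp : EqOn (u : E d → ℝ) p (closure Ω)) : (∃ x, p x = 0) ∧ affineGrad p ∈ ℝ ∙ ν := by
  obtain ⟨A, hA, hne, hpA⟩ := hside.exists_eqOn_zero huV hu hp
  refine ⟨⟨hne.some, hpA hne.some_mem⟩, ?_⟩
  rw [← (ℝ ∙ ν).orthogonal_orthogonal, ← hA]
  exact affineGrad_mem_orthogonal_direction hne hpA

theorem IsOuterNormal.mem_orthogonal_direction (hν : IsOuterNormal K F ν) :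
    ν ∈ (affineSpan ℝ (F : Set (E d))).directionᗮ := by
  rw [direction_affineSpan, vectorSpan_def, Submodule.mem_orthogonal']
  intro w hw
  refine LinearMap.mem_ker.1 ((Submodule.span_le (p := LinearMap.ker (innerₗ (E d) ν))).2 ?_ hw)
  rintro _ ⟨y, hy, x, hx, rfl⟩
  exact hν.2.1 x hx y hy

theorem IsSide.outerNormal_mem_span (hS : IsSide Ω S ν) (hF : F ∈ T.facets) (hK : K ∈ T.cellsAt F)
    (hpos : 0 < μHE[d - 1] (hull F ∩ S)) : outerNormal K F ∈ ℝ ∙ ν := by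
  obtain ⟨A, hA, hSA, -⟩ := hS.exists_affineSubspace
  rw [← finrank_orthogonal_span_singleton_of_norm_eq_one hS.2.1, ← hA, inter_comm] at hpos
  have hle : A ≤ affineSpan ℝ (F : Set (E d)) := le_of_euclideanHausdorffMeasure_inter_pos
    (hpos.trans_le (measure_mono (inter_subset_inter hSA hull_subset_affineSpan)))
  rw [← (ℝ ∙ ν).orthogonal_orthogonal, ← hA]
  exact Submodule.orthogonal_le (AffineSubspace.direction_le hle)
    (isOuterNormal_outerNormal hF hK).mem_orthogonal_direction

theorem HasNeumannSide.inner_affineGrad_eq_zero (hside : HasNeumannSide B ν) (hΩ : IsDomainSet Ω)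
    (hu : ∀ F ∈ T.boundaryFacets, 0 < μHE[d - 1] (hull F ∩ B.ΓN) →
      ∀ K ∈ T.cellsAt F, normalDeriv T K F u = 0)
    (hp : EqOn (u : E d → ℝ) p (closure Ω)) : ⟪ν, affineGrad p⟫_ℝ = 0 := by
  obtain ⟨S, hS, hSN⟩ := hside
  obtain ⟨A, hA, -, hSpos⟩ := hS.exists_affineSubspace
  rw [hA, finrank_orthogonal_span_singleton_of_norm_eq_one hS.2.1] at hSpos
  obtain ⟨F, hF, hpos⟩ := T.exists_boundaryFacet_measure_inter_pos hΩ hS.1 hSpos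
  obtain ⟨hFf, hcard⟩ := mem_boundaryFacets.1 hF
  obtain ⟨K, hK⟩ := Finset.card_pos.1 (hcard ▸ one_pos)
  have hKc := (mem_cellsAt.1 hK).1
  obtain ⟨t, ht⟩ := Submodule.mem_span_singleton.1 (hS.outerNormal_mem_span hFf hK hpos)
  have ht0 : t ≠ 0 := by
    rintro rfl
    simpa [← ht] using (isOuterNormal_outerNormal hFf hK).1
  have hderiv := hu F hF (hpos.trans_le (measure_mono (inter_subset_inter_right _ hSN))) K hK
  rw [normalDeriv_apply, cellGrad, LinearMap.comp_apply,
    cellAffine_eq hKc (hp.mono (hull_subset_closure hKc)), ← ht, real_inner_smul_left] at hderiv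
  exact (mul_eq_zero.1 hderiv).resolve_left ht0

end Sides

section Criteria

variable {Ω : Set (E d)} {T : Triangulation Ω} {V : Submodule ℝ (E d → ℝ)} {B : WeakBC Ω}
  {γ₁ : Finset (E d) → ℝ} {μ : ℝ} {u : T.P1} {p : E d →ᵃ[ℝ] ℝ}

theorem eq_smul_one_of_affineGrad_eq_zero (hp : EqOn (u : E d → ℝ) p (closure Ω))
    (hgrad : affineGrad p = 0) (x : E d) : (u : E d → ℝ) = p x • one Ω := by
  ext y
  by_cases hy : y ∈ closure Ω
  · have hconst := inner_affineGrad_sub p x y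
    rw [hgrad, inner_zero_left, eq_comm, sub_eq_zero] at hconst
    simp [one, hy, hp hy, hconst]
  · simp [one, hy, u.2.2.1 y hy]

theorem eq_zero_of_affineGrad_eq_zero (hp : EqOn (u : E d → ℝ) p (closure Ω))
    (hgrad : affineGrad p = 0) (hx : ∃ x, p x = 0) : u = 0 := by
  obtain ⟨x, hx⟩ := hx
  exact Subtype.ext ((eq_smul_one_of_affineGrad_eq_zero hp hgrad x).trans
    (by rw [hx, zero_smul]; rfl))

theorem TwoDirichletSides.eq_zero (h : TwoDirichletSides V B) (hd : 2 ≤ d) (hΩ : IsDomainSet Ω)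
    (hγ₁ : ∀ F ∈ T.interiorFacets, 0 < γ₁ F) (hμ : 0 < μ)
    (hu : u ∈ LinearMap.ker (stabForm T hΩ γ₁ μ B)) (huV : (u : E d → ℝ) ∈ V) : u = 0 := by
  obtain ⟨⟨p, hp⟩, hD, -⟩ :=
    exists_affineMap_and_boundary_conditions_of_mem_ker_stabForm hd hΩ hγ₁ hμ hu
  obtain ⟨ν₁, ν₂, h₁, h₂, hν⟩ := h
  obtain ⟨hx, hgrad₁⟩ := h₁.exists_eq_zero_and_affineGrad_mem_span huV hD hp
  obtain ⟨-, hgrad₂⟩ := h₂.exists_eq_zero_and_affineGrad_mem_span huV hD hp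
  refine eq_zero_of_affineGrad_eq_zero hp ?_ hx
  obtain ⟨s, hs⟩ := Submodule.mem_span_singleton.1 hgrad₁
  obtain ⟨t, ht⟩ := Submodule.mem_span_singleton.1 hgrad₂
  have hs0 := (LinearIndependent.pair_iff.1 hν s (-t) (by rw [neg_smul, hs, ht, add_neg_cancel])).1
  rw [← hs, hs0, zero_smul]

theorem DirichletNeumannSides.eq_zero (h : DirichletNeumannSides V B) (hd : 2 ≤ d)
    (hΩ : IsDomainSet Ω) (hγ₁ : ∀ F ∈ T.interiorFacets, 0 < γ₁ F) (hμ : 0 < μ)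
    (hu : u ∈ LinearMap.ker (stabForm T hΩ γ₁ μ B)) (huV : (u : E d → ℝ) ∈ V) : u = 0 := by
  obtain ⟨⟨p, hp⟩, hD, hN⟩ :=
    exists_affineMap_and_boundary_conditions_of_mem_ker_stabForm hd hΩ hγ₁ hμ hu
  obtain ⟨ν₁, ν₂, h₁, h₂, hν⟩ := h
  obtain ⟨hx, hgrad⟩ := h₁.exists_eq_zero_and_affineGrad_mem_span huV hD hp
  refine eq_zero_of_affineGrad_eq_zero hp ?_ hx
  obtain ⟨t, ht⟩ := Submodule.mem_span_singleton.1 hgrad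
  have hzero := h₂.inner_affineGrad_eq_zero hΩ hN hp
  rw [← ht, real_inner_smul_right, real_inner_comm] at hzero
  rw [← ht, (mul_eq_zero.1 hzero).resolve_right hν, zero_smul]

theorem IndependentNeumannSides.exists_eq_smul_one (h : IndependentNeumannSides B) (hd : 2 ≤ d)
    (hΩ : IsDomainSet Ω) (hγ₁ : ∀ F ∈ T.interiorFacets, 0 < γ₁ F) (hμ : 0 < μ)
    (hu : u ∈ LinearMap.ker (stabForm T hΩ γ₁ μ B)) : ∃ c : ℝ, (u : E d → ℝ) = c • one Ω := by
  obtain ⟨⟨p, hp⟩, -, hN⟩ :=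
    exists_affineMap_and_boundary_conditions_of_mem_ker_stabForm hd hΩ hγ₁ hμ hu
  obtain ⟨ν, hside, hν⟩ := h
  let basis := basisOfLinearIndependentOfCardEqFinrank' ν hν (by simp)
  have hgrad : affineGrad p = 0 := InnerProductSpace.ext_inner_left_basis basis fun i => by
    simpa [basis] using (hside i).inner_affineGrad_eq_zero hΩ hN hp
  exact ⟨_, eq_smul_one_of_affineGrad_eq_zero hp hgrad 0⟩

end Criteria

section Saddle

variable {V : Type*} [AddCommGroup V] [Module ℝ V] {a sp sa : LinearMap.BilinForm ℝ V}

/-- The operator `(u, z) ↦ (a(u, ·) + s_a(z, ·), a(·, z) - s_p(u, ·))` of the stabilised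
primal-dual system. -/
def saddle (a sp sa : LinearMap.BilinForm ℝ V) : V × V →ₗ[ℝ] Dual ℝ V × Dual ℝ V :=
  (a.coprod sa).prod ((-sp).coprod a.flip)

theorem saddle_eq_iff {ℓ₁ ℓ₂ : Dual ℝ V} {p : V × V} : saddle a sp sa p = (ℓ₁, ℓ₂) ↔
    (∀ w, a p.1 w + sa p.2 w = ℓ₁ w) ∧ ∀ v, a v p.2 - sp p.1 v = ℓ₂ v := by
  simp [saddle, LinearMap.ext_iff, sub_eq_neg_add]

/-- Testing with `(z, u)` and subtracting cancels `a(u, z)`. -/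
theorem ker_saddle_le (hsp : sp.IsPosSemidef) (hsa : sa.IsPosSemidef) :
    LinearMap.ker (saddle a sp sa) ≤ (LinearMap.ker sp).prod (LinearMap.ker sa) := by
  intro p hp
  obtain ⟨h₁, h₂⟩ := saddle_eq_iff.1 hp
  have hz : a p.1 p.2 + sa p.2 p.2 = 0 := h₁ p.2
  have hu : a p.1 p.2 - sp p.1 p.1 = 0 := h₂ p.1
  have hp₁ := hsp.nonneg p.1
  have hp₂ := hsa.nonneg p.2
  exact ⟨(mem_ker_iff_of_isPosSemidef hsp).2 (by linarith),
    (mem_ker_iff_of_isPosSemidef hsa).2 (by linarith)⟩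

theorem finrank_ker_saddle_le [FiniteDimensional ℝ V] (hsp : sp.IsPosSemidef)
    (hsa : sa.IsPosSemidef) : finrank ℝ (LinearMap.ker (saddle a sp sa)) ≤
      finrank ℝ (LinearMap.ker sp) + finrank ℝ (LinearMap.ker sa) := by
  let components : LinearMap.ker (saddle a sp sa) →ₗ[ℝ] LinearMap.ker sp × LinearMap.ker sa :=
    ((LinearMap.fst ℝ V V).restrict fun _ hp => (ker_saddle_le hsp hsa hp).1).prod
      ((LinearMap.snd ℝ V V).restrict fun _ hp => (ker_saddle_le hsp hsa hp).2)
  have hinj : Function.Injective components := fun p q h => Subtype.ext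
    (Prod.ext (congrArg (fun c => (c.1 : V)) h) (congrArg (fun c => (c.2 : V)) h))
  exact (LinearMap.finrank_le_finrank_of_injective hinj).trans_eq finrank_prod

theorem ker_saddle_eq_bot_of_ker_eq_bot (hsp : sp.IsPosSemidef) (hsa : sa.IsPosSemidef)
    (hker_sp : LinearMap.ker sp = ⊥) (hker_sa : LinearMap.ker sa = ⊥) :
    LinearMap.ker (saddle a sp sa) = ⊥ :=
  eq_bot_iff.2 ((ker_saddle_le hsp hsa).trans_eq (by rw [hker_sp, hker_sa, Submodule.prod_bot]))

theorem ker_saddle_eq_bot_of_ker_le_span (hsp : sp.IsPosSemidef) (hsa : sa.IsPosSemidef) {e v w : V}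
    (hker_sp : LinearMap.ker sp ≤ ℝ ∙ e) (hker_sa : LinearMap.ker sa ≤ ℝ ∙ e)
    (hv : a e v ≠ 0) (hw : a w e ≠ 0) : LinearMap.ker (saddle a sp sa) = ⊥ := by
  refine (Submodule.eq_bot_iff _).2 fun p hp => ?_
  obtain ⟨hu, hz⟩ := ker_saddle_le hsp hsa hp
  obtain ⟨h₁, h₂⟩ := saddle_eq_iff.1 hp
  obtain ⟨s, hs⟩ := Submodule.mem_span_singleton.1 (hker_sp hu)
  obtain ⟨t, ht⟩ := Submodule.mem_span_singleton.1 (hker_sa hz)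
  have hsv : s * a e v = 0 := by
    simpa [LinearMap.mem_ker.1 hz, ← hs] using h₁ v
  have htw : t * a w e = 0 := by
    simpa [LinearMap.mem_ker.1 hu, ← ht] using h₂ w
  refine Prod.ext ?_ ?_
  · rw [← hs, (mul_eq_zero.1 hsv).resolve_right hv, zero_smul, Prod.fst_zero]
  · rw [← ht, (mul_eq_zero.1 htw).resolve_right hw, zero_smul, Prod.snd_zero]

theorem existsUnique_saddle_eq [FiniteDimensional ℝ V] (hker : LinearMap.ker (saddle a sp sa) = ⊥)
    (ℓ : Dual ℝ V × Dual ℝ V) : ∃! p, saddle a sp sa p = ℓ := by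
  have hdim : finrank ℝ (V × V) = finrank ℝ (Dual ℝ V × Dual ℝ V) := by
    rw [finrank_prod, finrank_prod, Subspace.dual_finrank_eq]
  have hinj := LinearMap.ker_eq_bot.1 hker
  have hsurj := (LinearMap.injective_iff_surjective_of_finrank_eq_finrank hdim).1 hinj
  exact (Function.bijective_iff_existsUnique _).1 ⟨hinj, hsurj⟩ ℓ

end Saddle

section DiscreteSystem

open LinearMap (BilinForm)

variable {Ω : Set (E d)} {T : Triangulation Ω} {V : Submodule ℝ (E d → ℝ)}
  {γ₁ γ₂ : Finset (E d) → ℝ} {μ : ℝ} {B Bp Ba : WeakBC Ω} {ah sp sa : BilinForm ℝ V}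

/-- The stabilisation as a bilinear form on the discrete space `V`. -/
def stabFormOn (hΩ : IsDomainSet Ω) (hV : V ≤ T.P1) (γ₁ : Finset (E d) → ℝ) (μ : ℝ)
    (B : WeakBC Ω) : BilinForm ℝ V :=
  (stabForm T hΩ γ₁ μ B).comp (Submodule.inclusion hV) (Submodule.inclusion hV)

theorem isPosSemidef_stabFormOn (hd : 2 ≤ d) (hΩ : IsDomainSet Ω) (hV : V ≤ T.P1)
    (hγ₁ : ∀ F ∈ T.interiorFacets, 0 < γ₁ F) (hμ : 0 < μ) :
    (stabFormOn hΩ hV γ₁ μ B).IsPosSemidef :=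
  isPosSemidef_comp (isPosSemidef_stabForm hΩ
    (T.meshSize_pos (by omega) hΩ.connected.nonempty) hγ₁ hμ) _

theorem inclusion_mem_ker_stabForm (hd : 2 ≤ d) (hΩ : IsDomainSet Ω) (hV : V ≤ T.P1)
    (hγ₁ : ∀ F ∈ T.interiorFacets, 0 < γ₁ F) (hμ : 0 < μ) {u : V}
    (hu : u ∈ LinearMap.ker (stabFormOn hΩ hV γ₁ μ B)) :
    Submodule.inclusion hV u ∈ LinearMap.ker (stabForm T hΩ γ₁ μ B) :=
  (mem_ker_comp_iff (isPosSemidef_stabForm hΩ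
    (T.meshSize_pos (by omega) hΩ.connected.nonempty) hγ₁ hμ)).1 hu

theorem solvesFEM_iff_saddle_eq (hΩ : IsDomainSet Ω) (hV : V ≤ T.P1) {ℓ₁ ℓ₂ : Dual ℝ V}
    {p : V × V} : SolvesFEM ah (stab T γ₁ γ₂ μ Bp) (stab T γ₁ γ₂ μ Ba) ℓ₁ ℓ₂ p ↔
      saddle ah (stabFormOn hΩ hV γ₁ μ Bp) (stabFormOn hΩ hV γ₁ μ Ba) p = (ℓ₁, ℓ₂) := by
  simp only [saddle_eq_iff, SolvesFEM, stabFormOn, BilinForm.comp_apply, stabForm_apply (γ₂ := γ₂),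
    Submodule.coe_inclusion]

theorem finrank_ker_stabFormOn_le (hd : 2 ≤ d) (hΩ : IsDomainSet Ω) (hV : V ≤ T.P1)
    (hγ₁ : ∀ F ∈ T.interiorFacets, 0 < γ₁ F) (hμ : 0 < μ) :
    finrank ℝ (LinearMap.ker (stabFormOn hΩ hV γ₁ μ B)) ≤ d + 1 := by
  obtain ⟨K, hK⟩ := T.cells_nonempty hΩ.connected.nonempty
  let restrictToCell := (T.cellAffine K ∘ₗ Submodule.inclusion hV).domRestrict
    (LinearMap.ker (stabFormOn hΩ hV γ₁ μ B))
  have hinj : Function.Injective restrictToCell := by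
    refine (injective_iff_map_eq_zero _).2 fun u hu => ?_
    obtain ⟨⟨p, hp⟩, -⟩ := exists_affineMap_and_boundary_conditions_of_mem_ker_stabForm hd hΩ hγ₁ hμ
      (inclusion_mem_ker_stabForm hd hΩ hV hγ₁ hμ u.2)
    have hp0 : p = 0 := by
      rw [← Triangulation.cellAffine_eq hK (hp.mono (Triangulation.hull_subset_closure hK))]
      exact hu
    have hu0 : Submodule.inclusion hV u.1 = 0 :=
      eq_zero_of_affineGrad_eq_zero hp (by rw [hp0, map_zero]) ⟨0, by rw [hp0]; rfl⟩
    exact Subtype.ext ((map_eq_zero_iff _ (Submodule.inclusion_injective hV)).1 hu0)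
  have hle := LinearMap.finrank_le_finrank_of_injective hinj
  simpa [AffineMap.finrank_eq] using hle

theorem ker_stabFormOn_eq_bot (hd : 2 ≤ d) (hΩ : IsDomainSet Ω) (hV : V ≤ T.P1)
    (hγ₁ : ∀ F ∈ T.interiorFacets, 0 < γ₁ F) (hμ : 0 < μ)
    (h : TwoDirichletSides V B ∨ DirichletNeumannSides V B) :
    LinearMap.ker (stabFormOn hΩ hV γ₁ μ B) = ⊥ := by
  refine (Submodule.eq_bot_iff _).2 fun u hu => ?_
  have hu' := inclusion_mem_ker_stabForm hd hΩ hV hγ₁ hμ hu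
  have hzero : Submodule.inclusion hV u = 0 :=
    h.elim (·.eq_zero hd hΩ hγ₁ hμ hu' u.2) (·.eq_zero hd hΩ hγ₁ hμ hu' u.2)
  exact (map_eq_zero_iff _ (Submodule.inclusion_injective hV)).1 hzero

theorem coe_mem_span_one_of_mem_ker_stabFormOn (hd : 2 ≤ d) (hΩ : IsDomainSet Ω) (hV : V ≤ T.P1)
    (hγ₁ : ∀ F ∈ T.interiorFacets, 0 < γ₁ F) (hμ : 0 < μ) (h : IndependentNeumannSides B) {u : V}
    (hu : u ∈ LinearMap.ker (stabFormOn hΩ hV γ₁ μ B)) : (u : E d → ℝ) ∈ ℝ ∙ one Ω := by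
  obtain ⟨c, hc⟩ := h.exists_eq_smul_one hd hΩ hγ₁ hμ
    (inclusion_mem_ker_stabForm hd hΩ hV hγ₁ hμ hu)
  exact Submodule.mem_span_singleton.2 ⟨c, hc.symm⟩

theorem ker_saddle_eq_bot_of_constantsCondition (hsp : sp.IsPosSemidef) (hsa : sa.IsPosSemidef)
    (hker_sp : ∀ u ∈ LinearMap.ker sp, (u : E d → ℝ) ∈ ℝ ∙ one Ω)
    (hker_sa : ∀ u ∈ LinearMap.ker sa, (u : E d → ℝ) ∈ ℝ ∙ one Ω)
    (hconst : ConstantsCondition Ω ah) : LinearMap.ker (saddle ah sp sa) = ⊥ := by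
  rcases hconst with hone | ⟨hone, v, w, hv, hw⟩
  · have hbot : ∀ u : V, (u : E d → ℝ) ∈ ℝ ∙ one Ω → u = 0 := fun u hu => by
      obtain ⟨c, hc⟩ := Submodule.mem_span_singleton.1 hu
      have hc0 : c = 0 := by_contra fun hne => hone ((V.smul_mem_iff hne).1 (hc ▸ u.2))
      exact Subtype.ext (by rw [← hc, hc0, zero_smul]; rfl)
    exact ker_saddle_eq_bot_of_ker_eq_bot hsp hsa
      ((Submodule.eq_bot_iff _).2 fun u hu => hbot u (hker_sp u hu))
      ((Submodule.eq_bot_iff _).2 fun u hu => hbot u (hker_sa u hu))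
  · have hspan : ∀ u : V, (u : E d → ℝ) ∈ ℝ ∙ one Ω → u ∈ ℝ ∙ (⟨one Ω, hone⟩ : V) := fun u hu => by
      obtain ⟨c, hc⟩ := Submodule.mem_span_singleton.1 hu
      exact Submodule.mem_span_singleton.2 ⟨c, Subtype.ext hc⟩
    exact ker_saddle_eq_bot_of_ker_le_span hsp hsa (fun u hu => hspan u (hker_sp u hu))
      (fun u hu => hspan u (hker_sa u hu)) hv hw

end DiscreteSystem

end CIP

end

theorem mainTheorem3_general (d : ℕ) (hd : 2 ≤ d)
    (Ω : Set (CIP.E d)) (hΩ : CIP.IsDomainSet Ω) (T : CIP.Triangulation Ω)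
    (V : Submodule ℝ (CIP.E d → ℝ)) (hV : V ≤ T.P1)
    (ah : V →ₗ[ℝ] V →ₗ[ℝ] ℝ)
    (γ₁ γ₂ : Finset (CIP.E d) → ℝ) (hγ₁ : ∀ F ∈ T.interiorFacets, 0 < γ₁ F)
    (μ : ℝ) (hμ : 0 < μ) (Bp Ba : CIP.WeakBC Ω) :
    (∃ N : Submodule ℝ (V × V),
      (∀ p : V × V, p ∈ N ↔
        CIP.SolvesFEM ah (CIP.stab T γ₁ γ₂ μ Bp) (CIP.stab T γ₁ γ₂ μ Ba) 0 0 p) ∧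
      Module.rank ℝ N ≤ (2 * (d + 1) : ℕ)) ∧
    ((CIP.TwoDirichletSides V Bp ∧ CIP.TwoDirichletSides V Ba) ∨
      (CIP.DirichletNeumannSides V Bp ∧ CIP.DirichletNeumannSides V Ba) ∨
      (CIP.IndependentNeumannSides Bp ∧ CIP.IndependentNeumannSides Ba ∧
        CIP.ConstantsCondition Ω ah) →
      ∀ ℓ₁ ℓ₂ : V →ₗ[ℝ] ℝ, ∃! p : V × V,
        CIP.SolvesFEM ah (CIP.stab T γ₁ γ₂ μ Bp) (CIP.stab T γ₁ γ₂ μ Ba) ℓ₁ ℓ₂ p) := by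
  have hVfin : FiniteDimensional ℝ V := Submodule.finiteDimensional_of_le hV
  have hsp := CIP.isPosSemidef_stabFormOn (B := Bp) hd hΩ hV hγ₁ hμ
  have hsa := CIP.isPosSemidef_stabFormOn (B := Ba) hd hΩ hV hγ₁ hμ
  simp_rw [CIP.solvesFEM_iff_saddle_eq hΩ hV]
  refine ⟨⟨LinearMap.ker (CIP.saddle ah _ _), fun p => Iff.rfl, ?_⟩, fun hsides ℓ₁ ℓ₂ =>
    CIP.existsUnique_saddle_eq ?_ _⟩
  · rw [← Module.finrank_eq_rank, Nat.cast_le, two_mul]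
    exact (CIP.finrank_ker_saddle_le hsp hsa).trans
      (add_le_add (CIP.finrank_ker_stabFormOn_le hd hΩ hV hγ₁ hμ)
        (CIP.finrank_ker_stabFormOn_le hd hΩ hV hγ₁ hμ))
  rcases hsides with ⟨hp, ha⟩ | ⟨hp, ha⟩ | ⟨hp, ha, hconst⟩
  · exact CIP.ker_saddle_eq_bot_of_ker_eq_bot hsp hsa
      (CIP.ker_stabFormOn_eq_bot hd hΩ hV hγ₁ hμ (.inl hp))
      (CIP.ker_stabFormOn_eq_bot hd hΩ hV hγ₁ hμ (.inl ha))
  · exact CIP.ker_saddle_eq_bot_of_ker_eq_bot hsp hsa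
      (CIP.ker_stabFormOn_eq_bot hd hΩ hV hγ₁ hμ (.inr hp))
      (CIP.ker_stabFormOn_eq_bot hd hΩ hV hγ₁ hμ (.inr ha))
  · exact CIP.ker_saddle_eq_bot_of_constantsCondition hsp hsa
      (fun _ => CIP.coe_mem_span_one_of_mem_ker_stabFormOn hd hΩ hV hγ₁ hμ hp)
      (fun _ => CIP.coe_mem_span_one_of_mem_ker_stabFormOn hd hΩ hV hγ₁ hμ ha) hconst

theorem mainTheorem3 (d : ℕ) (hd : d = 2 ∨ d = 3)
    (Ω : Set (CIP.E d)) (hΩ : CIP.IsDomainSet Ω) (T : CIP.Triangulation Ω)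
    (V : Submodule ℝ (CIP.E d → ℝ)) (hV : V ≤ T.P1)
    (ah : V →ₗ[ℝ] V →ₗ[ℝ] ℝ)
    (γ₁ γ₂ : Finset (CIP.E d) → ℝ) (hγ₁ : ∀ F ∈ T.interiorFacets, 0 < γ₁ F)
    (hγ₂ : ∀ F ∈ T.interiorFacets, 0 ≤ γ₂ F)
    (μ : ℝ) (hμ : 0 < μ) (Bp Ba : CIP.WeakBC Ω) :
    (∃ N : Submodule ℝ (V × V),
      (∀ p : V × V, p ∈ N ↔
        CIP.SolvesFEM ah (CIP.stab T γ₁ γ₂ μ Bp) (CIP.stab T γ₁ γ₂ μ Ba) 0 0 p) ∧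
      Module.rank ℝ N ≤ (2 * (d + 1) : ℕ)) ∧
    ((CIP.TwoDirichletSides V Bp ∧ CIP.TwoDirichletSides V Ba) ∨
      (CIP.DirichletNeumannSides V Bp ∧ CIP.DirichletNeumannSides V Ba) ∨
      (CIP.IndependentNeumannSides Bp ∧ CIP.IndependentNeumannSides Ba ∧
        CIP.ConstantsCondition Ω ah) →
      ∀ ℓ₁ ℓ₂ : V →ₗ[ℝ] ℝ, ∃! p : V × V,
        CIP.SolvesFEM ah (CIP.stab T γ₁ γ₂ μ Bp) (CIP.stab T γ₁ γ₂ μ Ba) ℓ₁ ℓ₂ p) :=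
  mainTheorem3_general d (by omega) Ω hΩ T V hV ah γ₁ γ₂ hγ₁ μ hμ Bp Ba
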